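/- Let $\mathcal H$ be an infinite-dimensional complex Hilbert space (not necessarily separable), $\mathcal B(\mathcal H)$ the bounded linear operators on $\mathcal H$ with operator norm $\|\cdot\|_\infty$, and let $\Phi:[0,\infty)\to[0,\infty)$ be an Orlicz function, that is, $\Phi$ is left-continuous, convex and nondecreasing, $\Phi(0)=0$, and $\Phi$ is not identically zero. Assume that $\Phi(u)>0$ for all $u\neq 0$. Let $l^\Phi$ be the space of all bounded complex sequences $\xi=\{\xi_n\}_{n\ge1}$ such that $\sum_{n}\Phi(|\xi_n|/a)<\infty$ for some $a>0$, with the Luxemburg norm $\|\xi\|_\Phi=\inf\{a>0:\sum_{n}\Phi(|\xi_n|/a)\le 1\}$. For a compact operator $x$ on $\mathcal H$ let $s_1(x)\ge s_2(x)\ge\dots$ be its singular values, i.e. the eigenvalues of $|x|=(x^*x)^{1/2}$ in decreasing order, repeated according to multiplicity and followed by zeros if necessary. Let $$\mathcal C^\Phi=\{x\in\mathcal B(\mathcal H):\ x \text{ compact},\ \{s_n(x)\}\in l^\Phi\},\qquad \|x\|_\Phi=\|\{s_n(x)\}\|_\Phi .$$ Let $\tau(y)=\sum_j (y\varphi_j,\varphi_j)$,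 for $y\ge0$ and an orthonormal basis $(\varphi_j)$ of $\mathcal H$, be the canonical trace, and let $\mathcal C^1$ be the set of compact operators $x$ with $\|x\|_1=\tau(|x|)<\infty$. A linear map $T:\mathcal B(\mathcal H)\to\mathcal B(\mathcal H)$ is a Dunford–Schwartz operator if $T(\mathcal C^1)\subset\mathcal C^1$, $\|T(x)\|_1\le\|x\|_1$ for all $x\in\mathcal C^1$, and $\|T(x)\|_\infty\le\|x\|_\infty$ for all $x\in\mathcal B(\mathcal H)$. Put $A_n(T)(x)=\frac1{n+1}\sum_{k=0}^n T^k(x)$. Then: (i) $\mathcal C^\Phi$ satisfies the individual ergodic theorem: for every $x\in\mathcal C^\Phi$ and every Dunford–Schwartz operator $T$ there is $\widehat x\in\mathcal C^\Phi$ such that $\|A_n(T)(x)-\widehat x\|_\infty\to0$ as $n\to\infty$. (ii) $(\mathcal C^\Phi,\|\cdot\|_\Phi)$ satisfies the mean ergodic theorem, that is, for every $x\in\mathcal C^\Phi$ and every Dunford–Schwartz operator $T$ there is $\widehat x\in\mathcal C^\Phi$ such that $A_n(T)(x)-\widehat x\in\mathcal C^\Phi$ for all $n$ and $\|A_n(T)(x)-\widehat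 x\|_\Phi\to0$ as $n\to\infty$, if and only if $\Phi$ satisfies the $(\Delta_2)$-condition at $0$ (there are $u_0>0$ and $k>0$ with $\Phi(2u)<k\,\Phi(u)$ for all $0<u<u_0$) and $\lim_{u\to0}\Phi(u)/u=0$. -/

import Mathlib

open Filter Topology
open scoped NNReal ENNReal

namespace OrliczIdeal

noncomputable section

/-! ### Orlicz functions and Orlicz sequence spaces -/

/-- Orlicz functions: left-continuous, convex, increasing functions `[0,∞) → [0,∞)` which vanish
at `0` but not identically. "Increasing" is meant in the weak sense (nondecreasing). -/
structure IsOrliczFunction (Φ : ℝ≥0 → ℝ≥0) : Prop where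
  leftContinuous : ∀ u : ℝ≥0, ContinuousWithinAt Φ (Set.Iic u) u
  convex : ConvexOn ℝ≥0 Set.univ Φ
  monotone : Monotone Φ
  map_zero : Φ 0 = 0
  exists_pos : ∃ u : ℝ≥0, u ≠ 0 ∧ 0 < Φ u

/-- The modular `∑ₙ Φ(|ξₙ| / a)`, with value `∞` if the series diverges. -/
def modular (Φ : ℝ≥0 → ℝ≥0) (ξ : ℕ → ℂ) (a : ℝ≥0) : ℝ≥0∞ :=
  ∑' n : ℕ, (Φ (‖ξ n‖₊ / a) : ℝ≥0∞)

/-- The Orlicz sequence space `l^Φ`: the bounded complex sequences `ξ` such that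
`∑ₙ Φ(|ξₙ| / a) < ∞` for some `a > 0`. -/
def orliczSpace (Φ : ℝ≥0 → ℝ≥0) : Set (ℕ → ℂ) :=
  {ξ | Memℓp ξ ∞ ∧ ∃ a : ℝ≥0, 0 < a ∧ modular Φ ξ a < ∞}

/-- The Luxemburg norm `‖ξ‖_Φ = inf {a > 0 : ∑ₙ Φ(|ξₙ| / a) ≤ 1}`, for `ξ` in `l^Φ`. -/
def luxemburgNorm (Φ : ℝ≥0 → ℝ≥0) (ξ : ℕ → ℂ) : ℝ :=
  ((sInf {a : ℝ≥0 | 0 < a ∧ modular Φ ξ a ≤ 1} : ℝ≥0) : ℝ)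

/-- The `(Δ₂)`-condition at `0`. -/
def DeltaTwoAtZero (Φ : ℝ≥0 → ℝ≥0) : Prop :=
  ∃ u₀ : ℝ≥0, 0 < u₀ ∧ ∃ k : ℝ≥0, 0 < k ∧ ∀ u : ℝ≥0, 0 < u → u < u₀ → Φ (2 * u) < k * Φ u

/-! ### Singular values and ideals of compact operators -/

variable {H : Type*} [NormedAddCommGroup H] [InnerProductSpace ℂ H] [CompleteSpace H]

/-- The span of the eigenvectors of `|x| = (x* x)^{1/2}` whose eigenvalue is larger than `t`. For
`x` compact and `t ≥ 0`, its dimension is the number of eigenvalues of `|x|` that are larger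
than `t`, counted with multiplicity. -/
def eigenspanAbove (x : H →L[ℂ] H) (t : ℝ) : Submodule ℂ H :=
  ⨆ c : {c : ℝ // t < c}, Module.End.eigenspace ((CFC.abs x : H →L[ℂ] H) : H →ₗ[ℂ] H) ((c : ℝ) : ℂ)

/-- The singular values of a compact operator `x`: the eigenvalues of `|x|` in decreasing order,
repeated according to multiplicity, and followed by zeros if there are only finitely many nonzero
ones. The numbering starts at `0`: the value at `n` is the least `t ≥ 0` such that at most `n`
eigenvalues of `|x|`, counted with multiplicity, are larger than `t`. -/
def singularValue (x : H →L[ℂ] H) (n : ℕ) : ℝ :=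
  sInf {t : ℝ | 0 ≤ t ∧ Module.rank ℂ (eigenspanAbove x t) ≤ n}

/-- The singular values of `x` as a sequence of complex numbers. -/
def singularSeq (x : H →L[ℂ] H) : ℕ → ℂ := fun n => (singularValue x n : ℂ)

/-- The ideal `C_E` of compact operators whose sequence of singular values lies in `E`. -/
def compactIdeal (H : Type*) [NormedAddCommGroup H] [InnerProductSpace ℂ H] [CompleteSpace H]
    (E : Set (ℕ → ℂ)) : Set (H →L[ℂ] H) :=
  {x | IsCompactOperator x ∧ singularSeq x ∈ E}

/-- The Orlicz ideal `C^Φ`. -/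
def orliczIdeal (H : Type*) [NormedAddCommGroup H] [InnerProductSpace ℂ H] [CompleteSpace H]
    (Φ : ℝ≥0 → ℝ≥0) : Set (H →L[ℂ] H) :=
  compactIdeal H (orliczSpace Φ)

/-- The norm `‖x‖_Φ` of an element `x` of `C^Φ`: the Luxemburg norm of its singular values. -/
def orliczNorm (Φ : ℝ≥0 → ℝ≥0) (x : H →L[ℂ] H) : ℝ :=
  luxemburgNorm Φ (singularSeq x)

/-! ### The trace norm and Dunford-Schwartz operators -/

/-- The canonical trace `∑ⱼ (x φⱼ, φⱼ) ∈ [0,∞]` of a positive operator `x`, where `(φⱼ)` is an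
orthonormal basis of `H` (the value does not depend on which one). -/
def canonicalTrace (x : H →L[ℂ] H) : ℝ≥0∞ :=
  let φ := (exists_hilbertBasis ℂ H).choose_spec.choose
  ∑' j, ENNReal.ofReal (inner ℂ (φ j) (x (φ j))).re

/-- The trace norm `‖x‖₁ = τ(|x|) ∈ [0,∞]`. -/
def traceNorm (x : H →L[ℂ] H) : ℝ≥0∞ := canonicalTrace (CFC.abs x)

/-- The trace class `C¹`: the compact operators with finite trace norm. -/
def traceClass (H : Type*) [NormedAddCommGroup H] [InnerProductSpace ℂ H] [CompleteSpace H] :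
    Set (H →L[ℂ] H) :=
  {x | IsCompactOperator x ∧ traceNorm x < ∞}

/-- Dunford-Schwartz operators: the linear maps `T : B(H) → B(H)` that are contractions both for
the trace norm on `C¹` and for the operator norm on `B(H)`. -/
structure IsDunfordSchwartz (T : (H →L[ℂ] H) →ₗ[ℂ] (H →L[ℂ] H)) : Prop where
  map_traceClass : ∀ x ∈ traceClass H, T x ∈ traceClass H
  traceNorm_le : ∀ x ∈ traceClass H, traceNorm (T x) ≤ traceNorm x
  norm_le : ∀ x : H →L[ℂ] H, ‖T x‖ ≤ ‖x‖

/-! ### Ergodic theorems -/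

/-- The averages `Aₙ(T)(x) = (n + 1)⁻¹ ∑_{k = 0}^{n} T^k(x)`. -/
def average (T : (H →L[ℂ] H) →ₗ[ℂ] (H →L[ℂ] H)) (n : ℕ) (x : H →L[ℂ] H) : H →L[ℂ] H :=
  ((n : ℂ) + 1)⁻¹ • ∑ k ∈ Finset.range (n + 1), (T ^ k) x

/-- `X` satisfies the individual ergodic theorem: for all `x ∈ X` and all Dunford-Schwartz
operators `T`, the averages `Aₙ(T)(x)` converge in operator norm to an element of `X`. -/
def IndividualErgodicTheorem (X : Set (H →L[ℂ] H)) : Prop :=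
  ∀ x ∈ X, ∀ T : (H →L[ℂ] H) →ₗ[ℂ] (H →L[ℂ] H), IsDunfordSchwartz T →
    ∃ y ∈ X, Tendsto (fun n : ℕ => ‖average T n x - y‖) atTop (𝓝 0)

/-- `X`, with the norm `N` on it, satisfies the mean ergodic theorem: for all `x ∈ X` and all
Dunford-Schwartz operators `T`, the averages `Aₙ(T)(x)` converge in the norm `N` to an element
of `X`. Since `N` is only meaningful on `X`, membership of `Aₙ(T)(x) - y` is stated explicitly. -/
def MeanErgodicTheorem (X : Set (H →L[ℂ] H)) (N : (H →L[ℂ] H) → ℝ) : Prop :=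
  ∀ x ∈ X, ∀ T : (H →L[ℂ] H) →ₗ[ℂ] (H →L[ℂ] H), IsDunfordSchwartz T →
    ∃ y ∈ X, (∀ n : ℕ, average T n x - y ∈ X) ∧
      Tendsto (fun n : ℕ => N (average T n x - y)) atTop (𝓝 0)

end

end OrliczIdeal

/-! Everything goes through the Ky Fan sums `kyFan x m`, the sums of the `m` largest singular
values. Cutting `|x|` at its singular value of index `m` (counted from `0`) splits `x = y + z` with
`‖y‖₁ + m ‖z‖_∞ ≤ kyFan x m` (`exists_decomposition`). A Dunford–Schwartz operator contracts both
norms on the left, so it does not increase any Ky Fan sum (`IsDunfordSchwartz.kyFan_le`). Ky Fan's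
variational inequality makes these sums subadditive, so the averages do not increase them either.
Since convex nondecreasing functions respect weak majorization (`tsum_le_tsum_of_majorized`), bounds
on Ky Fan sums become bounds on Orlicz modulars.

For (i), majorization with `u ↦ u²` makes `T` a contraction for the Hilbert–Schmidt norm. The mean
ergodic theorem for pre-Hilbert spaces (`cauchySeq_cesaro`) makes the averages of Hilbert–Schmidt
operators Cauchy in that norm, hence in operator norm. The trace class is norm dense in the compact
operators and the averages are contractions, so all compact operators are covered. The limit
inherits the Ky Fan bounds of `x` and so stays in the ideal.

For sufficiency in (ii), `Δ₂` lets `x` be cut to a trace class operator with a remainder of small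
modular at any prescribed scale. On the trace class part the differences from the limit are bounded
in trace norm and tend to `0` in operator norm, and `Φ(t) ≤ η t` for small `t` makes their modular
small.

For necessity, conjugation by a unilateral shift is Dunford–Schwartz and moves diagonal entries one
place to the right. Its averages on a diagonal operator can only converge to `0`. A rank one
projection spreads to `n + 1` entries `1/(n + 1)`, which forces `Φ(u)/u → 0`. If `Δ₂` fails, there
is a decreasing diagonal `η` with `∑ Φ(η) < ∞ = ∑ Φ(2η)`; averaging does not lower its tail, so the
modular at scale `1/2` stays infinite. -/

namespace OrliczIdeal

/-! ### Decreasing rearrangements -/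

section Rearrangement

variable {ι κ : Type*}

/-- The decreasing rearrangement of a family of nonnegative real numbers. -/
noncomputable def rearrangement (f : ι → ℝ≥0) (n : ℕ) : ℝ≥0 :=
  sInf {t : ℝ≥0 | {i | t < f i}.encard ≤ n}

/-- Two families are equimeasurable if their superlevel sets have the same number of elements. -/
def Equimeasurable (f : ι → ℝ≥0) (g : κ → ℝ≥0) : Prop :=
  ∀ t : ℝ≥0, {i | t < f i}.encard = {k | t < g k}.encard

/-- A family tends to zero if its superlevel sets at positive levels are finite. -/
def FiniteSuperlevels (f : ι → ℝ≥0) : Prop :=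
  ∀ t : ℝ≥0, 0 < t → {i | t < f i}.Finite

theorem FiniteSuperlevels.exists_bound {f : ι → ℝ≥0} (hf : FiniteSuperlevels f) :
    ∃ C : ℝ≥0, ∀ i, f i ≤ C := by
  obtain ⟨C, hC⟩ := ((hf 1 one_pos).image f).bddAbove
  refine ⟨max C 1, fun i => ?_⟩
  by_cases h : 1 < f i
  · exact le_max_of_le_left (hC ⟨i, h, rfl⟩)
  · exact le_max_of_le_right (not_lt.1 h)

/-- The infimum is attained: among `n + 1` entries above `t` the least one still exceeds `t`, so
levels just below it are not admissible and the infimum cannot be `≤ t`. -/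
theorem rearrangement_le_iff {f : ι → ℝ≥0} (hf : FiniteSuperlevels f) {n : ℕ} {t : ℝ≥0} :
    rearrangement f n ≤ t ↔ {i | t < f i}.encard ≤ n := by
  refine ⟨fun h => ?_, fun h => csInf_le (OrderBot.bddBelow _) h⟩
  by_contra! hlt
  have hn : ((n + 1 : ℕ) : ℕ∞) ≤ {i | t < f i}.encard := by
    simpa using Order.add_one_le_of_lt hlt
  obtain ⟨F, hF, hFc⟩ := Set.exists_subset_encard_eq hn
  have hFfin : F.Finite := Set.finite_of_encard_eq_coe hFc
  have hne : F.Nonempty := by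
    rw [← Set.encard_pos, hFc]; simp
  obtain ⟨i₀, hi₀, hmin⟩ := Set.exists_min_image F f hFfin hne
  obtain ⟨C, hC⟩ := hf.exists_bound
  -- Boundedness of `f` is needed here: over an empty set the infimum would be the default value
  -- `0`.
  have hset : {t : ℝ≥0 | {i | t < f i}.encard ≤ n}.Nonempty := by
    refine ⟨C, ?_⟩
    have : {i | C < f i} = ∅ := by
      ext i; simpa using hC i
    simp [this]
  obtain ⟨u, hu, hlt'⟩ := (csInf_lt_iff (OrderBot.bddBelow _) hset).1
    (lt_of_le_of_lt h (hF hi₀ : t < f i₀))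
  have : F ⊆ {i | u < f i} := fun i hi => lt_of_lt_of_le hlt' (hmin i hi)
  have h1 := (Set.encard_le_encard this).trans hu
  rw [hFc] at h1
  exact absurd (Nat.cast_le.1 h1) (by omega)

theorem lt_rearrangement_iff {f : ι → ℝ≥0} (hf : FiniteSuperlevels f) {n : ℕ} {t : ℝ≥0} :
    t < rearrangement f n ↔ (n : ℕ∞) < {i | t < f i}.encard := by
  rw [← not_le, rearrangement_le_iff hf, not_le]

theorem encard_setOf_natCast_lt (E : ℕ∞) : {n : ℕ | (n : ℕ∞) < E}.encard = E := by
  induction E using ENat.recTopCoe with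
  | top => simp
  | coe m =>
    have : {n : ℕ | (n : ℕ∞) < m} = (Finset.range m : Set ℕ) := by
      ext n; simp
    rw [this, Set.encard_coe_eq_coe_finsetCard, Finset.card_range]

theorem equimeasurable_rearrangement {f : ι → ℝ≥0} (hf : FiniteSuperlevels f) :
    Equimeasurable f (rearrangement f) := by
  intro t
  simp_rw [lt_rearrangement_iff hf]
  exact (encard_setOf_natCast_lt _).symm

theorem rearrangement_antitone {f : ι → ℝ≥0} (hf : FiniteSuperlevels f) :
    Antitone (rearrangement f) := by
  intro m n hmn
  rw [rearrangement_le_iff hf]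
  exact ((rearrangement_le_iff hf).1 le_rfl).trans (by exact_mod_cast hmn)

theorem Equimeasurable.finiteSuperlevels {f : ι → ℝ≥0} {g : κ → ℝ≥0} (h : Equimeasurable f g)
    (hf : FiniteSuperlevels f) : FiniteSuperlevels g := by
  intro t ht
  rw [← Set.encard_lt_top_iff, ← h t, Set.encard_lt_top_iff]
  exact hf t ht

theorem le_rearrangement_zero {f : ι → ℝ≥0} (hf : FiniteSuperlevels f) (i : ι) :
    f i ≤ rearrangement f 0 := by
  have h := (rearrangement_le_iff hf (n := 0)).1 le_rfl
  have h0 : {i | rearrangement f 0 < f i} = ∅ := by simpa using h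
  by_contra! hlt
  exact (Set.ext_iff.1 h0 i).1 hlt

/-- A sequence with finite superlevel sets tends to zero. -/
theorem FiniteSuperlevels.tendsto {f : ℕ → ℝ≥0} (hf : FiniteSuperlevels f) :
    Tendsto f atTop (𝓝 0) := by
  refine NNReal.tendsto_coe.1 (Metric.tendsto_atTop.2 fun ε hε => ?_)
  obtain ⟨N, hN⟩ := (hf ⟨ε / 2, by positivity⟩ (by exact_mod_cast half_pos hε)).bddAbove
  refine ⟨N + 1, fun n hn => ?_⟩
  have h : ¬ ((⟨ε / 2, by positivity⟩ : ℝ≥0) < f n) := fun h => by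
    have := hN h; omega
  have h' : (f n : ℝ) ≤ ε / 2 := by exact_mod_cast not_lt.1 h
  simp only [NNReal.coe_zero, dist_zero_right, NNReal.norm_eq]
  linarith

/-- The layer cake formula for sums. -/
theorem tsum_eq_lintegral_encard (f : ι → ℝ≥0) :
    ∑' i, (f i : ℝ≥0∞) = ∫⁻ t in Set.Ioi (0 : ℝ), ({i | t.toNNReal < f i}.encard : ℝ≥0∞) := by
  let _ : MeasurableSpace ι := ⊤
  have : MeasurableSingletonClass ι := ⟨fun _ => trivial⟩
  rw [← MeasureTheory.lintegral_count]
  have := MeasureTheory.lintegral_eq_lintegral_meas_lt (MeasureTheory.Measure.count (α := ι))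
    (f := fun i => (f i : ℝ)) (Eventually.of_forall fun i => (f i).2)
    (Measurable.of_discrete.aemeasurable)
  simp only [ENNReal.ofReal_coe_nnreal] at this
  rw [this]
  refine MeasureTheory.setLIntegral_congr_fun measurableSet_Ioi fun t ht => ?_
  rw [MeasureTheory.Measure.count_apply (MeasurableSpace.measurableSet_top)]
  congr 2
  ext i
  simp only [Set.mem_ofPred_eq]
  rw [← NNReal.coe_lt_coe, Real.coe_toNNReal t (le_of_lt ht)]

/-- Equimeasurable families have the same sum. -/
theorem Equimeasurable.tsum_eq {f : ι → ℝ≥0} {g : κ → ℝ≥0} (h : Equimeasurable f g) :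
    ∑' i, (f i : ℝ≥0∞) = ∑' k, (g k : ℝ≥0∞) := by
  rw [tsum_eq_lintegral_encard, tsum_eq_lintegral_encard]
  simp_rw [h _]

theorem Equimeasurable.tsub {f : ι → ℝ≥0} {g : κ → ℝ≥0} (h : Equimeasurable f g) (c : ℝ≥0) :
    Equimeasurable (fun i => f i - c) (fun k => g k - c) := by
  intro t
  simp only [lt_tsub_iff_right]
  exact h (t + c)

theorem Equimeasurable.div {f : ι → ℝ≥0} {g : κ → ℝ≥0} (h : Equimeasurable f g) {a : ℝ≥0}
    (ha : 0 < a) : Equimeasurable (fun i => f i / a) (fun k => g k / a) := by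
  intro t
  simp only [lt_div_iff₀ ha]
  exact h (t * a)

/-- Equimeasurability is preserved by left-continuous nondecreasing functions. -/
theorem Equimeasurable.comp {f : ι → ℝ≥0} {g : κ → ℝ≥0} (h : Equimeasurable f g)
    {Φ : ℝ≥0 → ℝ≥0} (hm : Monotone Φ) (h0 : Φ 0 = 0)
    (hc : ∀ u : ℝ≥0, ContinuousWithinAt Φ (Set.Iic u) u) :
    Equimeasurable (fun i => Φ (f i)) (fun k => Φ (g k)) := by
  intro t
  -- By monotonicity `{Φ ≤ t}` is an initial segment. If it is bounded, left continuity puts its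
  -- supremum `c` inside, so `t < Φ u` means `c < u`; otherwise it is all of `ℝ≥0`.
  by_cases hb : BddAbove {u | Φ u ≤ t}
  · have hne : {u | Φ u ≤ t}.Nonempty := ⟨0, by simp [h0]⟩
    set c := sSup {u | Φ u ≤ t} with hcdef
    have hmem : Φ c ≤ t := by
      have hcl : c ∈ closure {u | Φ u ≤ t} := csSup_mem_closure hne hb
      have : (𝓝[{u | Φ u ≤ t}] c).NeBot := mem_closure_iff_nhdsWithin_neBot.1 hcl
      have hcont : Tendsto Φ (𝓝[{u | Φ u ≤ t}] c) (𝓝 (Φ c)) :=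
        (hc c).mono_left (nhdsWithin_mono _ fun u hu => le_csSup hb hu)
      exact le_of_tendsto hcont (eventually_mem_nhdsWithin.mono fun u hu => hu)
    have hiff : ∀ u, t < Φ u ↔ c < u := by
      intro u
      rw [← not_le, ← not_le, not_iff_not]
      exact ⟨fun hu => le_csSup hb hu, fun hu => (hm hu).trans hmem⟩
    simp only [hiff]
    exact h c
  · have hall : ∀ u, ¬ t < Φ u := by
      intro u
      rw [not_bddAbove_iff] at hb
      obtain ⟨v, hv, huv⟩ := hb u
      exact not_lt.2 ((hm huv.le).trans hv)
    simp [hall]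

/-- The truncated sum of a family and the partial sums of its rearrangement. -/
theorem tsum_tsub_add_eq_sum_rearrangement {f : ι → ℝ≥0} (hf : FiniteSuperlevels f) (m : ℕ) :
    ∑' i, ((f i - rearrangement f m : ℝ≥0) : ℝ≥0∞) + m * rearrangement f m =
      ∑ k ∈ Finset.range m, (rearrangement f k : ℝ≥0∞) := by
  -- After rearranging, the truncated terms of index `≥ m` vanish, and the others are plain
  -- differences.
  rw [((equimeasurable_rearrangement hf).tsub (rearrangement f m)).tsum_eq,
    tsum_eq_sum (s := Finset.range m)]
  · have : (m : ℝ≥0∞) * rearrangement f m = ∑ _k ∈ Finset.range m, (rearrangement f m : ℝ≥0∞) := by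
      simp
    rw [this, ← Finset.sum_add_distrib]
    refine Finset.sum_congr rfl fun k hk => ?_
    have := rearrangement_antitone hf (Finset.mem_range.1 hk).le
    rw [← ENNReal.coe_add, tsub_add_cancel_of_le this]
  · intro k hk
    have := rearrangement_antitone hf (not_lt.1 (Finset.mem_range.not.1 hk))
    simp [tsub_eq_zero_of_le this]

end Rearrangement

/-! ### Weak majorization -/

section Majorization

/-- Abel's inequality for antitone nonnegative weights. -/
theorem sum_mul_nonneg_of_antitone {p d : ℕ → ℝ} (hp : Antitone p) (hp0 : ∀ k, 0 ≤ p k)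
    (hd : ∀ m, 0 ≤ ∑ k ∈ Finset.range m, d k) (m : ℕ) :
    0 ≤ ∑ k ∈ Finset.range m, p k * d k := by
  -- This strengthening is what survives induction: lowering the weight from `p m` to `p (m + 1)`
  -- only decreases the left side, since the partial sum is nonnegative.
  have key : ∀ m, p m * ∑ k ∈ Finset.range m, d k ≤ ∑ k ∈ Finset.range m, p k * d k := by
    intro m
    induction m with
    | zero => simp
    | succ m ih =>
      rw [Finset.sum_range_succ (fun k => p k * d k)]
      calc p (m + 1) * ∑ k ∈ Finset.range (m + 1), d k
          ≤ p m * ∑ k ∈ Finset.range (m + 1), d k :=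
            mul_le_mul_of_nonneg_right (hp (Nat.le_succ m)) (hd _)
        _ = p m * ∑ k ∈ Finset.range m, d k + p m * d m := by
            rw [Finset.sum_range_succ]; ring
        _ ≤ _ := by linarith
  exact (mul_nonneg (hp0 m) (hd m)).trans (key m)

/-- The extension by the constant `Φ 0` to the left turns `0` into an interior point, where
one-sided derivatives of convex functions are available. -/
theorem convexOn_comp_toNNReal {Φ : ℝ≥0 → ℝ≥0} (hc : ConvexOn ℝ≥0 Set.univ Φ) (hm : Monotone Φ) :
    ConvexOn ℝ Set.univ fun u : ℝ => (Φ u.toNNReal : ℝ) := by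
  refine ⟨convex_univ, fun x _ y _ a b ha hb hab => ?_⟩
  lift a to ℝ≥0 using ha
  lift b to ℝ≥0 using hb
  have hab' : a + b = 1 := by exact_mod_cast hab
  have h1 : ((a : ℝ) • x + (b : ℝ) • y).toNNReal ≤ a • x.toNNReal + b • y.toNNReal := by
    rw [Real.toNNReal_le_iff_le_coe]
    push_cast [smul_eq_mul]
    gcongr <;> exact Real.le_coe_toNNReal _
  have h2 := (hm h1).trans (hc.2 (Set.mem_univ x.toNNReal) (Set.mem_univ y.toNNReal)
    (zero_le (a := a)) (zero_le (a := b)) hab')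
  exact_mod_cast h2

/-- A convex nondecreasing function has nonnegative supporting slopes that are nondecreasing. -/
theorem exists_monotone_slope {Φ : ℝ≥0 → ℝ≥0} (hc : ConvexOn ℝ≥0 Set.univ Φ) (hm : Monotone Φ) :
    ∃ p : ℝ≥0 → ℝ, Monotone p ∧ (∀ u, 0 ≤ p u) ∧
      ∀ u v : ℝ≥0, p u * ((v : ℝ) - u) ≤ (Φ v : ℝ) - Φ u := by
  set φ : ℝ → ℝ := fun u => (Φ u.toNNReal : ℝ) with hφ
  have hconv : ConvexOn ℝ Set.univ φ := convexOn_comp_toNNReal hc hm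
  have hmono : Monotone φ := fun x y h => by exact_mod_cast hm (Real.toNNReal_mono h)
  refine ⟨fun u => derivWithin φ (Set.Ioi (u : ℝ)) u, ?_, ?_, ?_⟩
  · intro u v huv
    exact hconv.monotoneOn_rightDeriv (by simp) (by simp) (by exact_mod_cast huv)
  · intro u
    exact (hmono.monotoneOn _).derivWithin_nonneg
  · intro u v
    have hu : φ u = Φ u := by simp [hφ]
    have hv : φ v = Φ v := by simp [hφ]
    rw [← hu, ← hv]
    rcases lt_trichotomy (u : ℝ) v with h | h | h
    · have := hconv.rightDeriv_le_slope_of_mem_interior (x := (u : ℝ)) (y := (v : ℝ)) (by simp)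
        (by simp) h
      rw [slope_def_field, le_div_iff₀ (sub_pos.2 h)] at this
      exact this
    · simp [h]
    · have h1 := hconv.slope_le_leftDeriv_of_mem_interior (x := (v : ℝ)) (y := (u : ℝ)) (by simp)
        (by simp) h
      have h2 := hconv.leftDeriv_le_rightDeriv_of_mem_interior (x := (u : ℝ)) (by simp)
      have h3 := h1.trans h2
      rw [slope_def_field, div_le_iff₀ (sub_pos.2 h)] at h3
      linarith

/-- **Weak majorization**: convex nondecreasing functions respect weak majorization of
nonincreasing sequences. -/
theorem sum_le_sum_of_majorized {Φ : ℝ≥0 → ℝ≥0} (hc : ConvexOn ℝ≥0 Set.univ Φ) (hm : Monotone Φ)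
    {r s : ℕ → ℝ≥0} (hr : Antitone r)
    (h : ∀ m, ∑ k ∈ Finset.range m, r k ≤ ∑ k ∈ Finset.range m, s k) (m : ℕ) :
    ∑ k ∈ Finset.range m, Φ (r k) ≤ ∑ k ∈ Finset.range m, Φ (s k) := by
  obtain ⟨p, hp, hp0, hsub⟩ := exists_monotone_slope hc hm
  -- Only the weights `p (r k)` have to be nonincreasing, so `s` needs no monotonicity. The
  -- supporting lines then give `Φ (s k) - Φ (r k) ≥ p (r k) (s k - r k)`.
  have hA := sum_mul_nonneg_of_antitone (p := fun k => p (r k)) (d := fun k => (s k : ℝ) - r k)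
    (fun i j hij => hp (hr hij)) (fun k => hp0 _)
    (fun m => by
      rw [Finset.sum_sub_distrib, sub_nonneg]
      exact_mod_cast h m) m
  have hB : ∑ k ∈ Finset.range m, p (r k) * ((s k : ℝ) - r k) ≤
      ∑ k ∈ Finset.range m, ((Φ (s k) : ℝ) - Φ (r k)) :=
    Finset.sum_le_sum fun k _ => hsub _ _
  rw [Finset.sum_sub_distrib] at hB
  have : (∑ k ∈ Finset.range m, (Φ (r k) : ℝ)) ≤ ∑ k ∈ Finset.range m, (Φ (s k) : ℝ) := by
    linarith
  exact_mod_cast this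

theorem tsum_le_tsum_of_majorized {Φ : ℝ≥0 → ℝ≥0} (hc : ConvexOn ℝ≥0 Set.univ Φ) (hm : Monotone Φ)
    {r s : ℕ → ℝ≥0} (hr : Antitone r)
    (h : ∀ m, ∑ k ∈ Finset.range m, r k ≤ ∑ k ∈ Finset.range m, s k) :
    ∑' k, (Φ (r k) : ℝ≥0∞) ≤ ∑' k, (Φ (s k) : ℝ≥0∞) := by
  rw [ENNReal.tsum_eq_iSup_nat]
  refine iSup_le fun m => le_trans ?_ (ENNReal.sum_le_tsum (Finset.range m))
  exact_mod_cast sum_le_sum_of_majorized hc hm hr h m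

end Majorization

/-! ### Eigenbases of the absolute value -/

section Eigenbasis

variable {H : Type*} [NormedAddCommGroup H] [InnerProductSpace ℂ H]

open scoped InnerProductSpace ComplexOrder

theorem hasSum_norm_inner_sq {ι : Type*} (b : HilbertBasis ι ℂ H) (v : H) :
    HasSum (fun i => ‖⟪b i, v⟫_ℂ‖ ^ 2) (‖v‖ ^ 2) := by
  have h := (b.hasSum_inner_mul_inner v v).mapL Complex.reCLM
  have h2 : Complex.reCLM ⟪v, v⟫_ℂ = ‖v‖ ^ 2 := by
    rw [inner_self_eq_norm_sq_to_K]
    norm_cast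
  rw [h2] at h
  refine h.congr_fun fun i => ?_
  rw [← inner_conj_symm v (b i), mul_comm, RCLike.mul_conj]
  norm_cast

theorem tsum_nnnorm_inner_sq {ι : Type*} (b : HilbertBasis ι ℂ H) (v : H) :
    ∑' i, ((‖⟪b i, v⟫_ℂ‖₊ ^ 2 : ℝ≥0) : ℝ≥0∞) = ((‖v‖₊ ^ 2 : ℝ≥0) : ℝ≥0∞) := by
  have h : HasSum (fun i => ‖⟪b i, v⟫_ℂ‖₊ ^ 2) (‖v‖₊ ^ 2) := by
    rw [← NNReal.hasSum_coe]
    simpa using hasSum_norm_inner_sq b v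
  exact (ENNReal.hasSum_coe.2 h).tsum_eq

/-- The Hilbert-Schmidt norm of a symmetric operator does not depend on the basis. -/
theorem tsum_nnnorm_sq_eq {ι κ : Type*} {c : H →L[ℂ] H} (hc : ∀ v w : H, ⟪c v, w⟫_ℂ = ⟪v, c w⟫_ℂ)
    (e : HilbertBasis κ ℂ H) (f : HilbertBasis ι ℂ H) :
    ∑' i, ((‖c (e i)‖₊ ^ 2 : ℝ≥0) : ℝ≥0∞) = ∑' j, ((‖c (f j)‖₊ ^ 2 : ℝ≥0) : ℝ≥0∞) := by
  -- Parseval in `f`, exchange of the two sums, then symmetry of `c` and Parseval in `e`.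
  rw [tsum_congr fun i => (tsum_nnnorm_inner_sq f (c (e i))).symm, ENNReal.tsum_comm]
  refine tsum_congr fun j => ?_
  rw [← tsum_nnnorm_inner_sq e (c (f j))]
  refine tsum_congr fun i => ?_
  rw [← hc, ← inner_conj_symm (e i) (c (f j)), RCLike.nnnorm_conj]

variable [CompleteSpace H]

theorem abs_isPositive (x : H →L[ℂ] H) : (CFC.abs x).IsPositive :=
  (ContinuousLinearMap.nonneg_iff_isPositive _).1 (CFC.abs_nonneg x)

theorem abs_apply_abs_apply (x : H →L[ℂ] H) (v : H) :
    CFC.abs x (CFC.abs x v) = (ContinuousLinearMap.adjoint x) (x v) := by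
  have h := CFC.abs_mul_abs x
  exact congrArg (fun T : H →L[ℂ] H => T v) h

theorem abs_inner_left (x : H →L[ℂ] H) (v w : H) :
    ⟪CFC.abs x v, w⟫_ℂ = ⟪v, CFC.abs x w⟫_ℂ :=
  (abs_isPositive x).isSymmetric v w

theorem norm_abs_apply (x : H →L[ℂ] H) (v : H) : ‖CFC.abs x v‖ = ‖x v‖ := by
  have h : ⟪CFC.abs x v, CFC.abs x v⟫_ℂ = ⟪x v, x v⟫_ℂ := by
    rw [abs_inner_left, abs_apply_abs_apply, ContinuousLinearMap.adjoint_inner_right]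
  rw [inner_self_eq_norm_sq_to_K, inner_self_eq_norm_sq_to_K] at h
  have h' : ‖CFC.abs x v‖ ^ 2 = ‖x v‖ ^ 2 := by exact_mod_cast h
  exact (pow_left_inj₀ (norm_nonneg _) (norm_nonneg _) two_ne_zero).1 h'

/-- Since `‖|x| v‖ = ‖x v‖`, preimages of an `ε`-net for the image of the ball under `x` give an
`ε`-net for its image under `|x|`. No polar decomposition is needed. -/
theorem isCompactOperator_abs {x : H →L[ℂ] H} (hx : IsCompactOperator x) :
    IsCompactOperator (CFC.abs x : H →L[ℂ] H) := by
  have hxc := (isCompactOperator_iff_isCompact_closure_image_closedBall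
    (x : H →ₗ[ℂ] H) one_pos).1 hx
  refine (isCompactOperator_iff_isCompact_closure_image_closedBall
    ((CFC.abs x : H →L[ℂ] H) : H →ₗ[ℂ] H) one_pos).2 ?_
  refine TotallyBounded.isCompact_of_isClosed (TotallyBounded.closure ?_) isClosed_closure
  rw [Metric.totallyBounded_iff]
  intro ε hε
  obtain ⟨t, hts, htf, hcov⟩ := Metric.finite_approx_of_totallyBounded
    (hxc.totallyBounded.subset subset_closure) ε hε
  have hts' : ∀ y ∈ t, ∃ v ∈ Metric.closedBall (0 : H) 1, x v = y := fun y hy => hts hy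
  choose! g hg using hts'
  refine ⟨(fun y => CFC.abs x (g y)) '' t, htf.image _, ?_⟩
  rintro _ ⟨v, hv, rfl⟩
  obtain ⟨y, hy, hvy⟩ := Set.mem_iUnion₂.1 (hcov ⟨v, hv, rfl⟩)
  refine Set.mem_iUnion₂.2 ⟨_, ⟨y, hy, rfl⟩, ?_⟩
  have hgy := (hg y hy).2
  rw [Metric.mem_ball, dist_eq_norm] at hvy ⊢
  change ‖CFC.abs x v - CFC.abs x (g y)‖ < ε
  rw [← map_sub, norm_abs_apply, map_sub]
  rw [← hgy] at hvy
  exact hvy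

/-- `b` is a Hilbert basis of eigenvectors of `|x|`, with eigenvalues `lam`. -/
def IsEigenbasis {ι : Type*} (x : H →L[ℂ] H) (b : HilbertBasis ι ℂ H) (lam : ι → ℝ≥0) : Prop :=
  ∀ i, CFC.abs x (b i) = ((lam i : ℝ) : ℂ) • b i

universe u in
-- Hilbert bases of all eigenspaces of `|x|`, the kernel included, are put together; the spectral
-- theorem for compact symmetric operators makes them total, and positivity makes the eigenvalues
-- nonnegative.
theorem exists_isEigenbasis {H : Type u} [NormedAddCommGroup H] [InnerProductSpace ℂ H]
    [CompleteSpace H] {x : H →L[ℂ] H} (hx : IsCompactOperator x) :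
    ∃ (ι : Type u) (b : HilbertBasis ι ℂ H) (lam : ι → ℝ≥0), IsEigenbasis x b lam := by
  set a : H →L[ℂ] H := CFC.abs x with ha
  have hsym : (a : H →ₗ[ℂ] H).IsSymmetric := (abs_isPositive x).isSymmetric
  have hbot := ContinuousLinearMap.orthogonalComplement_iSup_eigenspaces_eq_bot
    (isCompactOperator_abs hx) hsym
  have hcl : ∀ μ : ℂ, IsClosed (Module.End.eigenspace (a : H →ₗ[ℂ] H) μ : Set H) := by
    intro μ
    have : (Module.End.eigenspace (a : H →ₗ[ℂ] H) μ : Set H) = {v | a v = μ • v} := by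
      ext v; exact Module.End.mem_eigenspace_iff
    rw [this]
    exact isClosed_eq a.continuous (continuous_const_smul μ)
  have hcs : ∀ μ : ℂ, CompleteSpace (Module.End.eigenspace (a : H →ₗ[ℂ] H) μ) := fun μ =>
    (hcl μ).completeSpace_coe
  choose w c hc using fun μ : ℂ =>
    exists_hilbertBasis ℂ (Module.End.eigenspace (a : H →ₗ[ℂ] H) μ)
  let v : (Σ μ : ℂ, w μ) → H := fun p => (c p.1 p.2 : H)
  have hv : Orthonormal ℂ v :=
    hsym.orthogonalFamily_eigenspaces.orthonormal_sigma_orthonormal fun μ => (c μ).orthonormal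
  have hspan : (Submodule.span ℂ (Set.range v))ᗮ = ⊥ := by
    rw [← hbot, ← Submodule.orthogonal_closure]
    refine le_antisymm ?_ ?_
    · refine Submodule.orthogonal_le (iSup_le fun μ y hy => ?_)
      have hd := (c μ).dense_span
      have hmem : (⟨y, hy⟩ : Module.End.eigenspace (a : H →ₗ[ℂ] H) μ) ∈
          closure (Submodule.span ℂ (Set.range (c μ)) : Set _) := by
        have : (⟨y, hy⟩ : Module.End.eigenspace (a : H →ₗ[ℂ] H) μ) ∈
          (Submodule.span ℂ (Set.range (c μ))).topologicalClosure := by rw [hd]; trivial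
        exact this
      have := image_closure_subset_closure_image (continuous_subtype_val) ⟨_, hmem, rfl⟩
      refine closure_mono ?_ this
      rintro _ ⟨z, hz, rfl⟩
      have hz' : ((Module.End.eigenspace (a : H →ₗ[ℂ] H) μ).subtype z) ∈
        (Submodule.span ℂ (Set.range (c μ))).map (Module.End.eigenspace (a : H →ₗ[ℂ] H) μ).subtype :=
        Submodule.mem_map_of_mem hz
      rw [Submodule.map_span] at hz'
      refine Submodule.span_mono ?_ hz'
      rintro _ ⟨_, ⟨j, rfl⟩, rfl⟩
      exact ⟨⟨μ, j⟩, rfl⟩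
    · rw [Submodule.orthogonal_closure]
      refine Submodule.orthogonal_le (Submodule.span_le.2 ?_)
      rintro _ ⟨⟨μ, j⟩, rfl⟩
      exact Submodule.mem_iSup_of_mem μ (c μ j).2
  let b := HilbertBasis.mkOfOrthogonalEqBot hv hspan
  have hb : ∀ p, b p = v p := fun p => by
    rw [HilbertBasis.coe_mkOfOrthogonalEqBot]
  have heig : ∀ p, a (v p) = p.1 • v p := fun p =>
    Module.End.mem_eigenspace_iff.1 (c p.1 p.2).2
  have hre : ∀ p : Σ μ : ℂ, w μ, 0 ≤ p.1 := by
    intro p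
    have h := (abs_isPositive x).inner_nonneg_right (v p)
    rw [← ha, heig, inner_smul_right, inner_self_eq_norm_sq_to_K, hv.1 p] at h
    simpa using h
  refine ⟨_, b, fun p => p.1.re.toNNReal, fun p => ?_⟩
  rw [hb, ← ha, heig]
  congr 1
  have h := Complex.nonneg_iff.1 (hre p)
  rw [Real.coe_toNNReal _ h.1]
  exact Complex.ext (by simp) (by simpa using h.2.symm)

variable {ι : Type*} {x : H →L[ℂ] H} {b : HilbertBasis ι ℂ H} {lam : ι → ℝ≥0}

theorem IsEigenbasis.norm_apply (h : IsEigenbasis x b lam) (i : ι) : ‖x (b i)‖₊ = lam i := by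
  ext
  have := norm_abs_apply x (b i)
  rw [h i, norm_smul, b.orthonormal.1 i] at this
  simpa using this.symm

/-- The vectors `|x| b i = lam i • b i` with `lam i > t` lie in the image of the unit ball and are
more than `t` apart, so each of finitely many `t/2`-balls holds at most one. -/
theorem IsEigenbasis.finiteSuperlevels (h : IsEigenbasis x b lam) (hx : IsCompactOperator x) :
    FiniteSuperlevels lam := by
  intro t ht
  have hxc := (isCompactOperator_iff_isCompact_closure_image_closedBall
    ((CFC.abs x : H →L[ℂ] H) : H →ₗ[ℂ] H) one_pos).1 (isCompactOperator_abs hx)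
  obtain ⟨s, -, hsf, hcov⟩ := Metric.finite_approx_of_totallyBounded
    (hxc.totallyBounded.subset subset_closure) (t / 2) (by positivity)
  have hmem : ∀ i, ∃ y ∈ s, dist (((lam i : ℝ) : ℂ) • b i) y < t / 2 := by
    intro i
    obtain ⟨y, hy, hvy⟩ := Set.mem_iUnion₂.1 (hcov ⟨b i, by simp [b.orthonormal.1 i], rfl⟩)
    refine ⟨y, hy, ?_⟩
    rw [← h i]
    exact hvy
  choose g hgs hg using hmem
  refine Set.Finite.of_injOn (f := g) (t := s) (fun i _ => hgs i) ?_ hsf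
  intro i hi j hj hij
  by_contra hne
  have h1 : dist (((lam i : ℝ) : ℂ) • b i) (((lam j : ℝ) : ℂ) • b j) < t := by
    calc _ ≤ dist (((lam i : ℝ) : ℂ) • b i) (g i) + dist (((lam j : ℝ) : ℂ) • b j) (g i) :=
          dist_triangle_right _ _ _
      _ < t / 2 + t / 2 := add_lt_add (hg i) (hij ▸ hg j)
      _ = t := by ring
  have h2 := norm_inner_le_norm (𝕜 := ℂ) (b i) (((lam i : ℝ) : ℂ) • b i - ((lam j : ℝ) : ℂ) • b j)
  rw [inner_sub_right, inner_smul_right, inner_smul_right, b.orthonormal.2 hne,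
    inner_self_eq_norm_sq_to_K, b.orthonormal.1 i, ← dist_eq_norm] at h2
  have h3 : (t : ℝ) < lam i := by exact_mod_cast hi
  rw [dist_eq_norm] at h1 h2
  simp only [RCLike.ofReal_one, one_pow, mul_one,
    mul_zero, sub_zero, Complex.norm_real, NNReal.norm_eq, one_mul] at h2
  linarith

/-- An eigenvector for `c` is orthogonal to every `b i` with `lam i ≠ c`. As `c > 0`, only finitely
many `lam i` equal `c`, so its expansion is a finite sum and the algebraic span suffices. -/
theorem IsEigenbasis.eigenspanAbove_eq (h : IsEigenbasis x b lam) (hx : IsCompactOperator x)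
    (t : ℝ≥0) :
    eigenspanAbove x t = Submodule.span ℂ (b '' {i | t < lam i}) := by
  refine le_antisymm (iSup_le ?_) (Submodule.span_le.2 ?_)
  · rintro ⟨c, hc⟩ v hv
    have hv' : CFC.abs x v = (c : ℂ) • v := Module.End.mem_eigenspace_iff.1 hv
    have hcpos : 0 < c := lt_of_le_of_lt t.2 hc
    have hzero : ∀ i, (lam i : ℝ) ≠ c → ⟪b i, v⟫_ℂ = 0 := by
      intro i hi
      have h1 := abs_inner_left x (b i) v
      rw [hv', h i, inner_smul_left, inner_smul_right, Complex.conj_ofReal] at h1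
      have h2 : (((lam i : ℝ) : ℂ) - c) * ⟪b i, v⟫_ℂ = 0 := by rw [sub_mul, h1, sub_self]
      rcases mul_eq_zero.1 h2 with h3 | h3
      · exact absurd (by exact_mod_cast sub_eq_zero.1 h3) hi
      · exact h3
    have hfin : {i | (lam i : ℝ) = c}.Finite := by
      refine (h.finiteSuperlevels hx (c / 2).toNNReal (by simpa using hcpos)).subset fun i hi => ?_
      have hi' : (lam i : ℝ) = c := hi
      change _ < lam i
      rw [← NNReal.coe_lt_coe, Real.coe_toNNReal _ (by positivity), hi']
      linarith
    have hsum := b.hasSum_repr v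
    have heq : v = ∑ i ∈ hfin.toFinset, b.repr v i • b i := by
      refine hsum.unique (hasSum_sum_of_ne_finset_zero fun i hi => ?_)
      rw [b.repr_apply_apply, hzero i (by simpa using hi), zero_smul]
    rw [heq]
    refine Submodule.sum_mem _ fun i hi => Submodule.smul_mem _ _ (Submodule.subset_span ⟨i, ?_, rfl⟩)
    have hi' : (lam i : ℝ) = c := by simpa using hi
    change t < lam i
    rw [← NNReal.coe_lt_coe, hi']
    exact hc
  · rintro _ ⟨i, hi, rfl⟩
    exact Submodule.mem_iSup_of_mem (p := fun c : {c : ℝ // (t : ℝ) < c} =>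
      Module.End.eigenspace ((CFC.abs x : H →L[ℂ] H) : H →ₗ[ℂ] H) ((c : ℝ) : ℂ))
      ⟨(lam i : ℝ), by exact_mod_cast hi⟩ (Module.End.mem_eigenspace_iff.2 (h i))

theorem IsEigenbasis.rank_le_iff (h : IsEigenbasis x b lam) (hx : IsCompactOperator x)
    (t : ℝ≥0) (n : ℕ) :
    Module.rank ℂ (eigenspanAbove x t) ≤ n ↔ {i | t < lam i}.encard ≤ n := by
  have hinj : Function.Injective b := b.orthonormal.linearIndependent.injective
  rw [h.eigenspanAbove_eq hx, rank_span_set]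
  · rw [← hinj.encard_image, ← Cardinal.toENat_le_natCast]
    rfl
  · exact b.orthonormal.linearIndependent.linearIndepOn_id.mono (Set.image_subset_range _ _)

/-- The singular values are the decreasing rearrangement of the eigenvalues of `|x|`. -/
theorem IsEigenbasis.singularValue_eq (h : IsEigenbasis x b lam) (hx : IsCompactOperator x)
    (n : ℕ) : singularValue x n = rearrangement lam n := by
  rw [singularValue, rearrangement, NNReal.coe_sInf]
  congr 1
  ext t
  constructor
  · rintro ⟨ht, hr⟩
    lift t to ℝ≥0 using ht
    exact ⟨t, (h.rank_le_iff hx t n).1 hr, rfl⟩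
  · rintro ⟨t, ht, rfl⟩
    exact ⟨t.2, (h.rank_le_iff hx t n).2 ht⟩

/-- An eigenbasis of `x* x` is an eigenbasis of `|x|`. -/
theorem isEigenbasis_of_adjoint_apply
    (h : ∀ i, ContinuousLinearMap.adjoint x (x (b i)) = (((lam i : ℝ) : ℂ) ^ 2) • b i) :
    IsEigenbasis x b lam := by
  intro i
  set w := CFC.abs x (b i) - ((lam i : ℝ) : ℂ) • b i with hw
  -- From `(|x| + λ)(|x| - λ) = |x|² - λ²`, which kills `b i`. Positivity of `|x|` then gives `λ
  -- ‖w‖² ≤ 0`, which settles every case except `λ = 0`.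
  have hkey : CFC.abs x w = -(((lam i : ℝ) : ℂ) • w) := by
    rw [hw, map_sub, map_smul, abs_apply_abs_apply, h i, smul_sub, smul_smul]
    rw [← sq]
    abel
  have hpos := (abs_isPositive x).re_inner_nonneg_right w
  rw [hkey, inner_neg_right, inner_smul_right, inner_self_eq_norm_sq_to_K] at hpos
  have hle : (lam i : ℝ) * ‖w‖ ^ 2 ≤ 0 := by
    have : RCLike.re (-(((lam i : ℝ) : ℂ) * ((‖w‖ : ℝ) : ℂ) ^ 2)) = -((lam i : ℝ) * ‖w‖ ^ 2) := by
      norm_cast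
    have h2 := hpos
    rw [show ((‖w‖ : ℝ) : ℂ) = ((‖w‖ : ℝ) : ℂ) from rfl] at this
    have h3 : 0 ≤ -((lam i : ℝ) * ‖w‖ ^ 2) := this ▸ h2
    linarith
  rcases eq_or_ne (lam i) 0 with h0 | h0
  · have : ‖x (b i)‖ = 0 := by
      have h1 := ContinuousLinearMap.adjoint_inner_left x (b i) (x (b i))
      rw [h i, h0] at h1
      simp only [NNReal.coe_zero, Complex.ofReal_zero, ne_eq, OfNat.ofNat_ne_zero,
        not_false_eq_true, zero_pow, zero_smul, inner_zero_left, inner_self_eq_norm_sq_to_K] at h1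
      simpa using (pow_eq_zero_iff two_ne_zero).1 h1.symm
    have h2 : CFC.abs x (b i) = 0 := by
      rw [← norm_eq_zero, norm_abs_apply, this]
    rw [h2, h0]
    simp
  · have hl : 0 < (lam i : ℝ) := by
      exact_mod_cast pos_iff_ne_zero.2 h0
    have hw0 : ‖w‖ ^ 2 = 0 := le_antisymm (by nlinarith) (by positivity)
    have : w = 0 := by simpa using hw0
    exact sub_eq_zero.1 this

/-! ### The trace norm -/

/-- With `c = √a`, the trace is the squared Hilbert–Schmidt norm of `c`, which is independent of the
basis. -/
theorem canonicalTrace_eq {a : H →L[ℂ] H} (ha : 0 ≤ a) {ι : Type*} (b : HilbertBasis ι ℂ H) :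
    canonicalTrace a = ∑' i, ENNReal.ofReal (⟪b i, a (b i)⟫_ℂ).re := by
  set c : H →L[ℂ] H := CFC.sqrt a with hc
  have hcsym : ∀ v w : H, ⟪c v, w⟫_ℂ = ⟪v, c w⟫_ℂ :=
    ((ContinuousLinearMap.nonneg_iff_isPositive c).1 (CFC.sqrt_nonneg a)).isSymmetric
  have hcc : ∀ v, c (c v) = a v := fun v =>
    congrArg (fun T : H →L[ℂ] H => T v) (CFC.sqrt_mul_sqrt_self a ha)
  have hterm : ∀ v, ENNReal.ofReal (⟪v, a v⟫_ℂ).re = ((‖c v‖₊ ^ 2 : ℝ≥0) : ℝ≥0∞) := by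
    intro v
    rw [← hcc, ← hcsym, inner_self_eq_norm_sq_to_K, ← ENNReal.ofReal_coe_nnreal]
    congr 1
    norm_cast
  exact (tsum_congr fun j => hterm _).trans
    ((tsum_nnnorm_sq_eq hcsym _ b).trans (tsum_congr fun i => (hterm _).symm))

theorem IsEigenbasis.traceNorm_eq (h : IsEigenbasis x b lam) :
    traceNorm x = ∑' i, (lam i : ℝ≥0∞) := by
  rw [traceNorm, canonicalTrace_eq (CFC.abs_nonneg x) b]
  refine tsum_congr fun i => ?_
  rw [h i, inner_smul_right, inner_self_eq_norm_sq_to_K, b.orthonormal.1 i,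
    ← ENNReal.ofReal_coe_nnreal]
  simp

end Eigenbasis

/-! ### Finite sets attaining the partial sums of the rearrangement -/

section

variable {ι : Type*}

/-- Values cannot accumulate at a positive level `t` from below, so some `u < t` has no value of `f`
strictly between `u` and `t`; then every entry above `u` is at least `t`. -/
theorem FiniteSuperlevels.natCast_lt_encard {f : ι → ℝ≥0} (hf : FiniteSuperlevels f) {m : ℕ}
    (hm : 0 < rearrangement f m) : (m : ℕ∞) < {i | rearrangement f m ≤ f i}.encard := by
  set t := rearrangement f m with ht
  have hfin : {i | t / 2 < f i}.Finite := hf _ (half_pos hm)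
  obtain ⟨u, hu0, hut, hu⟩ : ∃ u, t / 2 ≤ u ∧ u < t ∧ ∀ i, f i < t → f i ≤ u := by
    rcases ({i | t / 2 < f i ∧ f i < t}).eq_empty_or_nonempty with h | h
    · refine ⟨t / 2, le_rfl, half_lt_self hm, fun i hi => ?_⟩
      by_contra! hlt
      exact (Set.ext_iff.1 h i).1 ⟨hlt, hi⟩
    · obtain ⟨j, hj, hmax⟩ := Set.exists_max_image _ f (hfin.subset fun i hi => hi.1) h
      refine ⟨f j, hj.1.le, hj.2, fun i hi => ?_⟩
      by_cases hi' : t / 2 < f i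
      · exact hmax i ⟨hi', hi⟩
      · exact (not_lt.1 hi').trans hj.1.le
  refine ((lt_rearrangement_iff hf).1 hut).trans_le (Set.encard_le_encard fun i hi => ?_)
  by_contra hlt
  exact absurd (hu i (not_le.1 hlt)) (not_le.2 hi)

/-- The partial sums of the rearrangement are attained as sums over finite sets. -/
theorem FiniteSuperlevels.exists_sum_eq {f : ι → ℝ≥0} (hf : FiniteSuperlevels f) (m : ℕ) :
    ∃ s : Finset ι, s.card ≤ m ∧
      ∑ i ∈ s, f i = ∑ k ∈ Finset.range m, rearrangement f k := by
  set t := rearrangement f m with ht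
  have hcard : {i | t < f i}.encard ≤ m := (rearrangement_le_iff hf).1 le_rfl
  -- The set lies between `{t < f}` and `{t ≤ f}`. For `t > 0` it is filled up with ties to exactly
  -- `m` elements; for `t = 0` there may be too few, but the missing ones contribute nothing.
  obtain ⟨s, hs1, hs2, hs3, hs4⟩ : ∃ s : Finset ι, s.card ≤ m ∧ (∀ i, t < f i → i ∈ s) ∧
      (∀ i ∈ s, t ≤ f i) ∧ (s.card : ℝ≥0∞) * t = m * t := by
    rcases eq_or_ne t 0 with h0 | h0
    · have hfin : {i | t < f i}.Finite := Set.finite_of_encard_le_coe hcard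
      refine ⟨hfin.toFinset, ?_, fun i hi => by simpa using hi, fun i _ => by simp [h0], by simp [h0]⟩
      rw [hfin.encard_eq_coe_toFinset_card] at hcard
      exact_mod_cast hcard
    · have hlt := hf.natCast_lt_encard (m := m) (pos_iff_ne_zero.2 h0)
      obtain ⟨G, hFG, hG, hGc⟩ := Set.exists_superset_subset_encard_eq
        (s := {i | t < f i}) (t := {i | t ≤ f i}) (fun i (hi : t < f i) => (hi.le : t ≤ f i)) hcard hlt.le
      have hGf : G.Finite := Set.finite_of_encard_eq_coe hGc
      have hc : hGf.toFinset.card = m := by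
        rw [hGf.encard_eq_coe_toFinset_card] at hGc
        exact_mod_cast hGc
      exact ⟨hGf.toFinset, hc.le, fun i hi => by simpa using hFG hi,
        fun i hi => hG (by simpa using hi), by rw [hc]⟩
  refine ⟨s, hs1, ?_⟩
  have hsum := tsum_tsub_add_eq_sum_rearrangement hf m
  rw [← ht, tsum_eq_sum (s := s) fun i hi => by
    simp [tsub_eq_zero_of_le (not_lt.1 fun h => hi (hs2 i h))], ← hs4] at hsum
  have h2 : ∑ i ∈ s, ((f i - t : ℝ≥0) : ℝ≥0∞) + s.card * t = ∑ i ∈ s, (f i : ℝ≥0∞) := by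
    rw [← nsmul_eq_mul, ← Finset.sum_const, ← Finset.sum_add_distrib]
    refine Finset.sum_congr rfl fun i hi => ?_
    rw [← ENNReal.coe_add, tsub_add_cancel_of_le (hs3 i hi)]
  rw [h2] at hsum
  exact_mod_cast hsum

end

/-! ### Diagonal operators -/

section Diagonal

open scoped InnerProductSpace

variable {H : Type*} [NormedAddCommGroup H] [InnerProductSpace ℂ H] {ι : Type*}

theorem ext_inner_hilbertBasis (b : HilbertBasis ι ℂ H) {v w : H}
    (h : ∀ i, ⟪b i, v⟫_ℂ = ⟪b i, w⟫_ℂ) : v = w := by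
  apply b.repr.injective
  ext i
  rw [b.repr_apply_apply, b.repr_apply_apply, h]

theorem norm_le_of_inner_le (b : HilbertBasis ι ℂ H) {v w : H} {C : ℝ} (hC : 0 ≤ C)
    (h : ∀ i, ‖⟪b i, w⟫_ℂ‖ ≤ C * ‖⟪b i, v⟫_ℂ‖) : ‖w‖ ≤ C * ‖v‖ := by
  have h1 := hasSum_le (fun i => pow_le_pow_left₀ (norm_nonneg _) (h i) 2)
    (hasSum_norm_inner_sq b w)
    (((hasSum_norm_inner_sq b v).mul_left (C ^ 2)).congr_fun fun i => by rw [mul_pow])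
  rw [← mul_pow] at h1
  exact le_of_sq_le_sq h1 (by positivity)

theorem exists_diagonal (b : HilbertBasis ι ℂ H) {d : ι → ℝ≥0} {C : ℝ≥0} (hd : ∀ i, d i ≤ C) :
    ∃ D : H →L[ℂ] H, ∀ v i, ⟪b i, D v⟫_ℂ = ((d i : ℝ) : ℂ) * ⟪b i, v⟫_ℂ := by
  have hle : ∀ v i, ‖((d i : ℝ) : ℂ) * ⟪b i, v⟫_ℂ‖ ≤ C * ‖⟪b i, v⟫_ℂ‖ := by
    intro v i
    rw [norm_mul, Complex.norm_real, NNReal.norm_eq]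
    exact mul_le_mul_of_nonneg_right (by exact_mod_cast hd i) (norm_nonneg _)
  have hmem : ∀ v : H, Memℓp (fun i => ((d i : ℝ) : ℂ) * ⟪b i, v⟫_ℂ) 2 := by
    intro v
    refine memℓp_gen ?_
    simp only [ENNReal.toReal_ofNat, Real.rpow_ofNat]
    refine Summable.of_nonneg_of_le (fun i => by positivity) (fun i => ?_)
      ((hasSum_norm_inner_sq b v).summable.mul_left ((C : ℝ) ^ 2))
    rw [← mul_pow]
    exact pow_le_pow_left₀ (norm_nonneg _) (hle v i) 2
  have hinner : ∀ v i, ⟪b i, b.repr.symm ⟨_, hmem v⟩⟫_ℂ = ((d i : ℝ) : ℂ) * ⟪b i, v⟫_ℂ := by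
    intro v i
    rw [← b.repr_apply_apply, LinearIsometryEquiv.apply_symm_apply]
  refine ⟨LinearMap.mkContinuous
    { toFun := fun v => b.repr.symm ⟨_, hmem v⟩
      map_add' := fun v w => ext_inner_hilbertBasis b fun i => ?_
      map_smul' := fun c v => ext_inner_hilbertBasis b fun i => ?_ } C fun v => ?_, fun v i => ?_⟩
  · rw [hinner, inner_add_right, inner_add_right, hinner, hinner, mul_add]
  · rw [hinner, inner_smul_right, RingHom.id_apply, inner_smul_right, hinner, mul_left_comm]
  · refine norm_le_of_inner_le b C.2 fun i => ?_
    change ‖⟪b i, b.repr.symm ⟨_, hmem v⟩⟫_ℂ‖ ≤ _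
    rw [hinner]
    exact hle v i
  · exact hinner v i

open Classical in
/-- The operator that is diagonal with respect to `b`, with diagonal entries `d`. -/
noncomputable def diagonalOp (b : HilbertBasis ι ℂ H) (d : ι → ℝ≥0) : H →L[ℂ] H :=
  if h : BddAbove (Set.range d) then
    (exists_diagonal b (C := h.choose) fun i => h.choose_spec ⟨i, rfl⟩).choose
  else 0

theorem inner_diagonalOp (b : HilbertBasis ι ℂ H) {d : ι → ℝ≥0} {C : ℝ≥0} (hd : ∀ i, d i ≤ C)
    (v : H) (i : ι) : ⟪b i, diagonalOp b d v⟫_ℂ = ((d i : ℝ) : ℂ) * ⟪b i, v⟫_ℂ := by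
  have h : BddAbove (Set.range d) := ⟨C, by rintro _ ⟨i, rfl⟩; exact hd i⟩
  rw [diagonalOp, dif_pos h]
  exact (exists_diagonal b (C := h.choose) fun i => h.choose_spec ⟨i, rfl⟩).choose_spec v i

theorem diagonalOp_apply (b : HilbertBasis ι ℂ H) {d : ι → ℝ≥0} {C : ℝ≥0} (hd : ∀ i, d i ≤ C)
    (i : ι) : diagonalOp b d (b i) = ((d i : ℝ) : ℂ) • b i := by
  refine ext_inner_hilbertBasis b fun j => ?_
  rw [inner_diagonalOp b hd, inner_smul_right]
  rcases eq_or_ne j i with rfl | h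
  · rfl
  · rw [b.orthonormal.2 h, mul_zero, mul_zero]

theorem norm_diagonalOp_le (b : HilbertBasis ι ℂ H) {d : ι → ℝ≥0} {C : ℝ≥0} (hd : ∀ i, d i ≤ C) :
    ‖diagonalOp b d‖ ≤ C := by
  refine ContinuousLinearMap.opNorm_le_bound _ C.2 fun v => norm_le_of_inner_le b C.2 fun i => ?_
  rw [inner_diagonalOp b hd, norm_mul, Complex.norm_real, NNReal.norm_eq]
  exact mul_le_mul_of_nonneg_right (by exact_mod_cast hd i) (norm_nonneg _)

theorem ext_hilbertBasis (b : HilbertBasis ι ℂ H) {S T : H →L[ℂ] H} (h : ∀ i, S (b i) = T (b i)) :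
    S = T := by
  refine ContinuousLinearMap.ext_on (s := Set.range b) ?_ ?_
  · rw [dense_iff_closure_eq, ← Submodule.topologicalClosure_coe, b.dense_span]
    rfl
  · rintro _ ⟨i, rfl⟩
    exact h i

theorem isCompactOperator_smulRight (f : H →L[ℂ] ℂ) (v : H) :
    IsCompactOperator (f.smulRight v) := by
  have h : IsCompactOperator (ContinuousLinearMap.toSpanSingleton ℂ v) :=
    isCompactOperator_of_locallyCompactSpace_rng (ContinuousLinearMap.toSpanSingleton ℂ v)
  exact h.comp_clm f

theorem isCompactOperator_sum {κ : Type*} (s : Finset κ) {f : κ → H →L[ℂ] H}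
    (h : ∀ i ∈ s, IsCompactOperator (f i)) : IsCompactOperator (∑ i ∈ s, f i : H →L[ℂ] H) := by
  classical
  induction s using Finset.induction_on with
  | empty => simpa using! isCompactOperator_zero
  | insert a s ha ih =>
    rw [Finset.sum_insert ha]
    exact (h a (Finset.mem_insert_self a s)).add
      (ih fun i hi => h i (Finset.mem_insert_of_mem hi))

theorem isCompactOperator_diagonalOp_of_finite (b : HilbertBasis ι ℂ H) {d : ι → ℝ≥0}
    (s : Finset ι) (hs : ∀ i ∉ s, d i = 0) : IsCompactOperator (diagonalOp b d) := by
  classical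
  have hd : ∀ i, d i ≤ ∑ j ∈ s, d j := by
    intro i
    by_cases hi : i ∈ s
    · exact Finset.single_le_sum (fun _ _ => zero_le) hi
    · rw [hs i hi]; exact zero_le
  have heq : diagonalOp b d =
      ∑ i ∈ s, (innerSL ℂ (b i)).smulRight (((d i : ℝ) : ℂ) • b i) := by
    refine ext_hilbertBasis b fun j => ?_
    rw [diagonalOp_apply b hd, sum_apply]
    simp only [ContinuousLinearMap.smulRight_apply, innerSL_apply_apply,
      orthonormal_iff_ite.1 b.orthonormal, ite_smul, one_smul, zero_smul]
    rw [Finset.sum_ite_eq']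
    split_ifs with h
    · rfl
    · rw [hs j h]; simp
  rw [heq]
  exact isCompactOperator_sum s fun i _ => isCompactOperator_smulRight _ _

variable [CompleteSpace H]

theorem adjoint_diagonalOp (b : HilbertBasis ι ℂ H) {d : ι → ℝ≥0} {C : ℝ≥0} (hd : ∀ i, d i ≤ C) :
    ContinuousLinearMap.adjoint (diagonalOp b d) = diagonalOp b d := by
  refine ContinuousLinearMap.ext fun v => ext_inner_hilbertBasis b fun i => ?_
  rw [ContinuousLinearMap.adjoint_inner_right, diagonalOp_apply b hd, inner_smul_left,
    inner_diagonalOp b hd, Complex.conj_ofReal]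

/-- Dropping the entries up to `1/(n + 1)` leaves finite rank and costs at most `1/(n + 1)` in norm.
-/
theorem isCompactOperator_diagonalOp (b : HilbertBasis ι ℂ H) {d : ι → ℝ≥0}
    (hd : FiniteSuperlevels d) : IsCompactOperator (diagonalOp b d) := by
  classical
  obtain ⟨C, hC⟩ := hd.exists_bound
  let e : ℕ → ι → ℝ≥0 := fun n i => if ((n : ℝ≥0) + 1)⁻¹ < d i then d i else 0
  have he : ∀ n i, e n i ≤ C := by
    intro n i
    simp only [e]
    split_ifs
    exacts [hC i, zero_le]
  have hcomp : ∀ n, IsCompactOperator (diagonalOp b (e n)) := by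
    intro n
    refine isCompactOperator_diagonalOp_of_finite b
      (hd ((n : ℝ≥0) + 1)⁻¹ (by positivity)).toFinset fun i hi => ?_
    have : ¬ ((n : ℝ≥0) + 1)⁻¹ < d i := by simpa using hi
    simp only [e, if_neg this]
  have hsub : ∀ n, ‖diagonalOp b (e n) - diagonalOp b d‖ ≤ ((n : ℝ) + 1)⁻¹ := by
    intro n
    refine ContinuousLinearMap.opNorm_le_bound _ (by positivity) fun v =>
      norm_le_of_inner_le b (by positivity) fun i => ?_
    rw [sub_apply, inner_sub_right, inner_diagonalOp b hC,
      inner_diagonalOp b (he n), ← sub_mul, norm_mul]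
    refine mul_le_mul_of_nonneg_right ?_ (norm_nonneg _)
    simp only [e]
    split_ifs with h
    · simp only [sub_self, norm_zero]; positivity
    · rw [NNReal.coe_zero, Complex.ofReal_zero, zero_sub, norm_neg, Complex.norm_real,
        NNReal.norm_eq]
      exact_mod_cast not_lt.1 h
  refine isCompactOperator_of_tendsto (l := atTop) (F := fun n => diagonalOp b (e n)) ?_
    (Eventually.of_forall hcomp)
  rw [tendsto_iff_norm_sub_tendsto_zero]
  exact squeeze_zero (fun _ => norm_nonneg _) hsub (by
    simpa [one_div] using tendsto_one_div_add_atTop_nhds_zero_nat (𝕜 := ℝ))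

/-- Composition with a diagonal operator multiplies the singular values by its entries. -/
theorem IsEigenbasis.comp_diagonalOp {x : H →L[ℂ] H} {b : HilbertBasis ι ℂ H} {lam : ι → ℝ≥0}
    (h : IsEigenbasis x b lam) {d : ι → ℝ≥0} {C : ℝ≥0} (hd : ∀ i, d i ≤ C) :
    IsEigenbasis (x ∘L diagonalOp b d) b (fun i => lam i * d i) := by
  refine isEigenbasis_of_adjoint_apply fun i => ?_
  rw [ContinuousLinearMap.adjoint_comp, adjoint_diagonalOp b hd]
  simp only [ContinuousLinearMap.comp_apply]
  rw [diagonalOp_apply b hd, map_smul, map_smul, ← abs_apply_abs_apply, h i]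
  simp only [map_smul, h i, diagonalOp_apply b hd, smul_smul]
  congr 1
  push_cast
  ring

theorem isEigenbasis_diagonalOp (b : HilbertBasis ι ℂ H) {d : ι → ℝ≥0} {C : ℝ≥0}
    (hd : ∀ i, d i ≤ C) : IsEigenbasis (diagonalOp b d) b d := by
  refine isEigenbasis_of_adjoint_apply fun i => ?_
  rw [adjoint_diagonalOp b hd, diagonalOp_apply b hd, map_smul, diagonalOp_apply b hd, smul_smul,
    sq]

theorem IsEigenbasis.norm_le {x : H →L[ℂ] H} {b : HilbertBasis ι ℂ H} {lam : ι → ℝ≥0}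
    (h : IsEigenbasis x b lam) {C : ℝ≥0} (hC : ∀ i, lam i ≤ C) : ‖x‖ ≤ C := by
  have heq : CFC.abs x = diagonalOp b lam :=
    ext_hilbertBasis b fun i => by rw [h i, diagonalOp_apply b hC]
  rw [← CFC.norm_abs, heq]
  exact norm_diagonalOp_le b hC

end Diagonal

/-! ### Ky Fan norms -/

section KyFan

open scoped InnerProductSpace

universe u

variable {H : Type u} [NormedAddCommGroup H] [InnerProductSpace ℂ H] {ι κ : Type*}

/-- A Bessel family: a family satisfying Bessel's inequality. -/
def IsBessel (f : ι → H) : Prop :=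
  ∀ (s : Finset ι) (v : H), ∑ i ∈ s, ‖⟪f i, v⟫_ℂ‖ ^ 2 ≤ ‖v‖ ^ 2

theorem Orthonormal.isBessel {f : ι → H} (hf : Orthonormal ℂ f) : IsBessel f :=
  fun _ v => hf.sum_inner_products_le v

theorem IsBessel.norm_le_one {f : ι → H} (hf : IsBessel f) (i : ι) : ‖f i‖ ≤ 1 := by
  have h := hf {i} (f i)
  rw [Finset.sum_singleton, inner_self_eq_norm_sq_to_K] at h
  have h3 : (‖f i‖ ^ 2) ^ 2 ≤ ‖f i‖ ^ 2 := by simpa using h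
  by_contra! hlt
  have : 1 < ‖f i‖ ^ 2 := by nlinarith
  nlinarith

theorem IsBessel.sum_mul_le {f e : ι → H} (hf : IsBessel f) (he : IsBessel e) (s : Finset ι)
    (v w : H) : ∑ i ∈ s, ‖⟪e i, v⟫_ℂ‖ * ‖⟪f i, w⟫_ℂ‖ ≤ ‖v‖ * ‖w‖ := by
  refine (Real.sum_mul_le_sqrt_mul_sqrt s _ _).trans ?_
  exact mul_le_mul (Real.sqrt_le_iff.2 ⟨norm_nonneg _, he s v⟩)
    (Real.sqrt_le_iff.2 ⟨norm_nonneg _, hf s w⟩) (Real.sqrt_nonneg _) (norm_nonneg _)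

theorem enorm_inner_le_tsum (b : HilbertBasis ι ℂ H) (y : H →L[ℂ] H) (u v : H) :
    ‖⟪u, y v⟫_ℂ‖ₑ ≤ ∑' j, ‖⟪b j, v⟫_ℂ‖ₑ * ‖⟪u, y (b j)⟫_ℂ‖ₑ := by
  have h := ((b.hasSum_repr v).mapL y).mapL (innerSL ℂ u)
  rw [← innerSL_apply_apply, ← h.tsum_eq]
  refine enorm_tsum_le_tsum_enorm.trans (le_of_eq (tsum_congr fun j => ?_))
  rw [map_smul, map_smul, smul_eq_mul, enorm_mul, b.repr_apply_apply, innerSL_apply_apply]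

/-- Duality between the trace norm and the operator norm. -/
theorem IsBessel.sum_enorm_inner_le (b : HilbertBasis κ ℂ H) {f e : ι → H} (hf : IsBessel f)
    (he : IsBessel e) (s : Finset ι) (y : H →L[ℂ] H) :
    ∑ i ∈ s, ‖⟪f i, y (e i)⟫_ℂ‖ₑ ≤ ∑' j, (‖y (b j)‖₊ : ℝ≥0∞) := by
  -- After expanding `e i` in `b` and exchanging sums, Cauchy–Schwarz and both Bessel inequalities
  -- bound the `j`-th term by `‖b j‖ ‖y (b j)‖`. For an eigenbasis of `y` the total is the trace
  -- norm.
  refine (Finset.sum_le_sum fun i _ => enorm_inner_le_tsum b y (f i) (e i)).trans ?_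
  rw [← Summable.tsum_finsetSum fun _ _ => ENNReal.summable]
  refine ENNReal.tsum_le_tsum fun j => ?_
  have h := hf.sum_mul_le he s (b j) (y (b j))
  rw [b.orthonormal.1 j, one_mul] at h
  have h' : ∑ i ∈ s, ‖⟪e i, b j⟫_ℂ‖₊ * ‖⟪f i, y (b j)⟫_ℂ‖₊ ≤ ‖y (b j)‖₊ := by
    rw [← NNReal.coe_le_coe]
    push_cast
    simpa only [coe_nnnorm] using h
  calc ∑ i ∈ s, ‖⟪b j, e i⟫_ℂ‖ₑ * ‖⟪f i, y (b j)⟫_ℂ‖ₑ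
      = ((∑ i ∈ s, ‖⟪e i, b j⟫_ℂ‖₊ * ‖⟪f i, y (b j)⟫_ℂ‖₊ : ℝ≥0) : ℝ≥0∞) := by
        push_cast
        refine Finset.sum_congr rfl fun i _ => ?_
        rw [← inner_conj_symm (b j) (e i), enorm_eq_nnnorm, enorm_eq_nnnorm, RCLike.nnnorm_conj]
    _ ≤ _ := by exact_mod_cast h'

variable [CompleteSpace H]

/-- The singular values as nonnegative real numbers. -/
noncomputable def sv (x : H →L[ℂ] H) (n : ℕ) : ℝ≥0 := (singularValue x n).toNNReal

/-- The Ky Fan norms: the partial sums of the singular values. -/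
noncomputable def kyFan (x : H →L[ℂ] H) (m : ℕ) : ℝ≥0 := ∑ k ∈ Finset.range m, sv x k

variable {x y z : H →L[ℂ] H} {b : HilbertBasis ι ℂ H} {lam : ι → ℝ≥0}

theorem IsEigenbasis.sv_eq (h : IsEigenbasis x b lam) (hx : IsCompactOperator x) :
    sv x = rearrangement lam := by
  funext n
  rw [sv, h.singularValue_eq hx, Real.toNNReal_coe]

theorem IsEigenbasis.equimeasurable_sv (h : IsEigenbasis x b lam) (hx : IsCompactOperator x) :
    Equimeasurable lam (sv x) := by
  rw [h.sv_eq hx]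
  exact equimeasurable_rearrangement (h.finiteSuperlevels hx)

theorem sv_antitone (hx : IsCompactOperator x) : Antitone (sv x) := by
  obtain ⟨ι, b, lam, h⟩ := exists_isEigenbasis hx
  rw [h.sv_eq hx]
  exact rearrangement_antitone (h.finiteSuperlevels hx)

theorem finiteSuperlevels_sv (hx : IsCompactOperator x) : FiniteSuperlevels (sv x) := by
  obtain ⟨ι, b, lam, h⟩ := exists_isEigenbasis hx
  exact (h.equimeasurable_sv hx).finiteSuperlevels (h.finiteSuperlevels hx)

theorem singularSeq_eq (hx : IsCompactOperator x) (n : ℕ) :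
    singularSeq x n = ((sv x n : ℝ) : ℂ) := by
  obtain ⟨ι, b, lam, h⟩ := exists_isEigenbasis hx
  rw [h.sv_eq hx, singularSeq, h.singularValue_eq hx]

theorem nnnorm_singularSeq (hx : IsCompactOperator x) (n : ℕ) :
    ‖singularSeq x n‖₊ = sv x n := by
  rw [singularSeq_eq hx]
  ext
  simp

theorem traceNorm_eq_tsum_sv (hx : IsCompactOperator x) :
    traceNorm x = ∑' k, (sv x k : ℝ≥0∞) := by
  obtain ⟨ι, b, lam, h⟩ := exists_isEigenbasis hx
  rw [h.traceNorm_eq, (h.equimeasurable_sv hx).tsum_eq]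

theorem kyFan_le_traceNorm (hx : IsCompactOperator x) (m : ℕ) :
    (kyFan x m : ℝ≥0∞) ≤ traceNorm x := by
  rw [traceNorm_eq_tsum_sv hx, kyFan]
  push_cast
  exact ENNReal.sum_le_tsum _

theorem traceNorm_le_of_kyFan_le (hx : IsCompactOperator x) {C : ℝ≥0∞}
    (h : ∀ m, (kyFan x m : ℝ≥0∞) ≤ C) : traceNorm x ≤ C := by
  rw [traceNorm_eq_tsum_sv hx, ENNReal.tsum_eq_iSup_nat]
  refine iSup_le fun m => ?_
  have := h m
  rw [kyFan] at this
  exact_mod_cast this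

theorem norm_le_sv_zero (hx : IsCompactOperator x) : ‖x‖₊ ≤ sv x 0 := by
  obtain ⟨ι, b, lam, h⟩ := exists_isEigenbasis hx
  have hb := le_rearrangement_zero (h.finiteSuperlevels hx)
  rw [h.sv_eq hx]
  exact h.norm_le hb

theorem kyFan_mono (x : H →L[ℂ] H) : Monotone (kyFan x) := fun _ _ hmn =>
  Finset.sum_le_sum_of_subset (Finset.range_mono hmn)

/-- A compact operator splits into a finite rank operator and an operator of small norm, in an
optimal way for the Ky Fan norm. -/
theorem exists_decomposition (hx : IsCompactOperator x) (m : ℕ) :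
    ∃ y z : H →L[ℂ] H, x = y + z ∧ y ∈ traceClass H ∧ ‖z‖₊ ≤ sv x m ∧
      traceNorm y + m * ‖z‖₊ ≤ kyFan x m := by
  obtain ⟨ι, b, lam, h⟩ := exists_isEigenbasis hx
  have hfin := h.finiteSuperlevels hx
  set t := rearrangement lam m with ht
  -- These factors make the singular values of `y` equal to `(lam i - t)⁺`, leaving `min (lam i) t`
  -- for `z`. Where `lam i = 0`, the quotient is `0` and nothing is lost.
  let d : ι → ℝ≥0 := fun i => (lam i - t) / lam i
  let d' : ι → ℝ≥0 := fun i => 1 - d i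
  have hd : ∀ i, d i ≤ 1 := fun i => div_le_one_of_le₀ tsub_le_self zero_le
  have hd' : ∀ i, d' i ≤ 1 := fun i => tsub_le_self
  have hmul : ∀ i, lam i * d i = lam i - t := by
    intro i
    rcases eq_or_ne (lam i) 0 with h0 | h0
    · simp [h0]
    · exact mul_div_cancel₀ _ h0
  have hmul' : ∀ i, lam i * d' i ≤ t := by
    intro i
    simp only [d']
    rw [mul_tsub, mul_one, hmul, tsub_le_iff_right]
    rw [add_comm]
    exact le_tsub_add
  have hone : diagonalOp b d + diagonalOp b d' = ContinuousLinearMap.id ℂ H := by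
    refine ext_hilbertBasis b fun i => ?_
    rw [add_apply, diagonalOp_apply b hd, diagonalOp_apply b hd', ← add_smul,
      ContinuousLinearMap.id_apply]
    have : (d i : ℝ) + d' i = 1 := by
      have := add_tsub_cancel_of_le (hd i)
      exact_mod_cast this
    rw [← Complex.ofReal_add, this, Complex.ofReal_one, one_smul]
  have hy := h.comp_diagonalOp hd
  have hz := h.comp_diagonalOp hd'
  have hzn : ‖x ∘L diagonalOp b d'‖₊ ≤ t := hz.norm_le hmul'
  have htr : traceNorm (x ∘L diagonalOp b d) = ∑' i, ((lam i - t : ℝ≥0) : ℝ≥0∞) := by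
    rw [hy.traceNorm_eq]
    exact tsum_congr fun i => by rw [hmul]
  have hle : traceNorm (x ∘L diagonalOp b d) + m * ‖x ∘L diagonalOp b d'‖₊ ≤ kyFan x m := by
    have hs := tsum_tsub_add_eq_sum_rearrangement hfin m
    rw [htr, kyFan, h.sv_eq hx]
    push_cast
    rw [← hs]
    exact add_le_add le_rfl (mul_le_mul_right (ENNReal.coe_le_coe.2 hzn) _)
  refine ⟨x ∘L diagonalOp b d, x ∘L diagonalOp b d', ?_, ⟨hx.comp_clm _, ?_⟩, ?_, hle⟩
  · rw [← ContinuousLinearMap.comp_add, hone, ContinuousLinearMap.comp_id]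
  · exact (le_self_add.trans hle).trans_lt ENNReal.coe_lt_top
  · rw [h.sv_eq hx]
    exact hzn

/-- Ky Fan's inequality. -/
theorem IsBessel.sum_norm_inner_le_kyFan (hx : IsCompactOperator x) {f e : κ → H}
    (hf : IsBessel f) (he : IsBessel e) (s : Finset κ) :
    ∑ i ∈ s, ‖⟪f i, x (e i)⟫_ℂ‖₊ ≤ kyFan x s.card := by
  -- The part `y` is estimated by trace duality, the part `z` term by term by `‖z‖`; the optimal
  -- splitting adds these up to exactly the Ky Fan sum.
  obtain ⟨y, z, rfl, hy, -, hle⟩ := exists_decomposition hx s.card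
  obtain ⟨ι, b, lam, h⟩ := exists_isEigenbasis hy.1
  have h1 : ∑ i ∈ s, ‖⟪f i, y (e i)⟫_ℂ‖ₑ ≤ traceNorm y := by
    refine (hf.sum_enorm_inner_le b he s y).trans_eq ?_
    rw [h.traceNorm_eq]
    exact tsum_congr fun i => by rw [h.norm_apply]
  have h2 : ∑ i ∈ s, ‖⟪f i, z (e i)⟫_ℂ‖ₑ ≤ s.card * ‖z‖₊ := by
    rw [← nsmul_eq_mul, ← Finset.sum_const]
    refine Finset.sum_le_sum fun i _ => ?_
    rw [enorm_eq_nnnorm, ENNReal.coe_le_coe, ← NNReal.coe_le_coe, coe_nnnorm, coe_nnnorm]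
    calc ‖⟪f i, z (e i)⟫_ℂ‖ ≤ ‖f i‖ * ‖z (e i)‖ := norm_inner_le_norm _ _
      _ ≤ 1 * (‖z‖ * 1) := mul_le_mul (hf.norm_le_one i)
          ((z.le_opNorm _).trans (mul_le_mul_of_nonneg_left (he.norm_le_one i) (norm_nonneg _)))
          (norm_nonneg _) zero_le_one
      _ = ‖z‖ := by ring
  have h3 : (∑ i ∈ s, ‖⟪f i, (y + z) (e i)⟫_ℂ‖ₑ) ≤
      ∑ i ∈ s, ‖⟪f i, y (e i)⟫_ℂ‖ₑ + ∑ i ∈ s, ‖⟪f i, z (e i)⟫_ℂ‖ₑ := by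
    rw [← Finset.sum_add_distrib]
    refine Finset.sum_le_sum fun i _ => ?_
    rw [add_apply, inner_add_right]
    exact enorm_add_le _ _
  have h4 := (h3.trans (add_le_add h1 h2)).trans hle
  simp only [enorm_eq_nnnorm] at h4
  exact_mod_cast h4

/-- These are the left singular vectors: orthonormal where `lam i ≠ 0`, and zero elsewhere because
`0⁻¹ = 0`. Paired with `b` they realize the singular values as `⟪f i, x (b i)⟫`. -/
theorem IsEigenbasis.isBessel (h : IsEigenbasis x b lam) :
    IsBessel fun i => (((lam i : ℝ) : ℂ)⁻¹) • x (b i) := by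
  classical
  intro s v
  have hinner : ∀ i j, ⟪x (b i), x (b j)⟫_ℂ = if i = j then ((lam i : ℝ) : ℂ) ^ 2 else 0 := by
    intro i j
    rw [← ContinuousLinearMap.adjoint_inner_left, ← abs_apply_abs_apply, h i, map_smul, h i,
      smul_smul, inner_smul_left, orthonormal_iff_ite.1 b.orthonormal i j]
    split_ifs <;> simp [sq]
  have horth : Orthonormal ℂ fun i : {i // lam i ≠ 0} =>
      (((lam i : ℝ) : ℂ)⁻¹) • x (b i) := by
    rw [orthonormal_iff_ite]
    intro i j
    have hi : ((lam i : ℝ) : ℂ) ≠ 0 := by exact_mod_cast i.2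
    rw [inner_smul_left, inner_smul_right, hinner]
    by_cases hij : i = j
    · subst hij
      simp only [if_true, map_inv₀, Complex.conj_ofReal]
      field_simp
    · rw [if_neg hij, if_neg fun h => hij (Subtype.ext h)]
      simp
  have hb := Orthonormal.isBessel horth (s.subtype fun i => lam i ≠ 0) v
  refine le_trans (le_of_eq ?_) hb
  rw [Finset.sum_subtype_eq_sum_filter (f := fun i => ‖⟪(((lam i : ℝ) : ℂ)⁻¹) • x (b i), v⟫_ℂ‖ ^ 2)]
  symm
  refine Finset.sum_filter_of_ne fun i _ hi h0 => hi ?_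
  simp [h0]

/-- The Ky Fan norms are attained in Ky Fan's inequality. -/
theorem exists_kyFan_eq (hx : IsCompactOperator x) (m : ℕ) :
    ∃ (ι : Type u) (s : Finset ι) (f e : ι → H), s.card ≤ m ∧ IsBessel f ∧ IsBessel e ∧
      kyFan x m = ∑ i ∈ s, ‖⟪f i, x (e i)⟫_ℂ‖₊ := by
  obtain ⟨ι, b, lam, h⟩ := exists_isEigenbasis hx
  obtain ⟨s, hs, hsum⟩ := (h.finiteSuperlevels hx).exists_sum_eq m
  refine ⟨ι, s, _, b, hs, h.isBessel, Orthonormal.isBessel b.orthonormal, ?_⟩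
  rw [kyFan, h.sv_eq hx, ← hsum]
  refine Finset.sum_congr rfl fun i _ => ?_
  rw [inner_smul_left, inner_self_eq_norm_sq_to_K]
  ext
  have hn : ‖x (b i)‖ = lam i := by
    rw [← coe_nnnorm, h.norm_apply]
  rw [hn]
  rcases eq_or_ne (lam i) 0 with h0 | h0
  · simp [h0]
  · have : (lam i : ℝ) ≠ 0 := by exact_mod_cast h0
    simp
    field_simp

/-- With Ky Fan's inequality this presents `kyFan x m` as a maximum of seminorms in `x`, the source
of the estimates for sums and multiples below. -/
theorem kyFan_le_of_forall {C : ℝ≥0} {m : ℕ} (hx : IsCompactOperator x)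
    (h : ∀ (κ : Type u) (s : Finset κ) (f e : κ → H), s.card ≤ m → IsBessel f → IsBessel e →
      ∑ i ∈ s, ‖⟪f i, x (e i)⟫_ℂ‖₊ ≤ C) : kyFan x m ≤ C := by
  obtain ⟨κ, s, f, e, hs, hf, he, heq⟩ := exists_kyFan_eq hx m
  rw [heq]
  exact h κ s f e hs hf he

theorem kyFan_add_le (hx : IsCompactOperator x) (hy : IsCompactOperator y) (m : ℕ) :
    kyFan (x + y) m ≤ kyFan x m + kyFan y m := by
  refine kyFan_le_of_forall (hx.add hy) fun κ s f e hs hf he => ?_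
  calc ∑ i ∈ s, ‖⟪f i, (x + y) (e i)⟫_ℂ‖₊
      ≤ ∑ i ∈ s, (‖⟪f i, x (e i)⟫_ℂ‖₊ + ‖⟪f i, y (e i)⟫_ℂ‖₊) := by
        refine Finset.sum_le_sum fun i _ => ?_
        rw [add_apply, inner_add_right]
        exact nnnorm_add_le _ _
    _ ≤ kyFan x s.card + kyFan y s.card := by
        rw [Finset.sum_add_distrib]
        exact add_le_add (hf.sum_norm_inner_le_kyFan hx he s) (hf.sum_norm_inner_le_kyFan hy he s)
    _ ≤ _ := add_le_add (kyFan_mono x hs) (kyFan_mono y hs)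

theorem kyFan_smul_le (hx : IsCompactOperator x) (c : ℂ) (m : ℕ) :
    kyFan (c • x) m ≤ ‖c‖₊ * kyFan x m := by
  refine kyFan_le_of_forall (hx.smul c) fun κ s f e hs hf he => ?_
  calc ∑ i ∈ s, ‖⟪f i, (c • x) (e i)⟫_ℂ‖₊
      = ‖c‖₊ * ∑ i ∈ s, ‖⟪f i, x (e i)⟫_ℂ‖₊ := by
        rw [Finset.mul_sum]
        refine Finset.sum_congr rfl fun i _ => ?_
        rw [smul_apply, inner_smul_right, nnnorm_mul]
    _ ≤ ‖c‖₊ * kyFan x s.card := by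
        gcongr
        exact hf.sum_norm_inner_le_kyFan hx he s
    _ ≤ _ := by
        gcongr
        exact kyFan_mono x hs

theorem kyFan_le_mul_norm (hx : IsCompactOperator x) (m : ℕ) : kyFan x m ≤ m * ‖x‖₊ := by
  refine kyFan_le_of_forall hx fun κ s f e hs hf he => ?_
  calc ∑ i ∈ s, ‖⟪f i, x (e i)⟫_ℂ‖₊ ≤ ∑ i ∈ s, ‖x‖₊ := by
        refine Finset.sum_le_sum fun i _ => ?_
        rw [← NNReal.coe_le_coe, coe_nnnorm, coe_nnnorm]
        calc ‖⟪f i, x (e i)⟫_ℂ‖ ≤ ‖f i‖ * ‖x (e i)‖ := norm_inner_le_norm _ _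
          _ ≤ 1 * (‖x‖ * 1) := mul_le_mul (hf.norm_le_one i)
              ((x.le_opNorm _).trans (mul_le_mul_of_nonneg_left (he.norm_le_one i)
                (norm_nonneg _))) (norm_nonneg _) zero_le_one
          _ = ‖x‖ := by ring
    _ ≤ m * ‖x‖₊ := by
        rw [Finset.sum_const, nsmul_eq_mul]
        gcongr

theorem sv_zero_eq (hx : IsCompactOperator x) : sv x 0 = ‖x‖₊ := by
  refine le_antisymm ?_ (norm_le_sv_zero hx)
  simpa [kyFan] using kyFan_le_mul_norm hx 1

theorem kyFan_sub_le (hx : IsCompactOperator x) (hy : IsCompactOperator y) (m : ℕ) :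
    kyFan (x - y) m ≤ kyFan x m + kyFan y m := by
  have h := kyFan_smul_le hy (-1) m
  rw [nnnorm_neg, nnnorm_one, one_mul, neg_one_smul] at h
  rw [sub_eq_add_neg]
  exact (kyFan_add_le hx hy.neg m).trans (by gcongr)

theorem kyFan_sum_le (s : Finset κ) {f : κ → H →L[ℂ] H} (hf : ∀ i ∈ s, IsCompactOperator (f i))
    {C : ℝ≥0} {m : ℕ} (h : ∀ i ∈ s, kyFan (f i) m ≤ C) :
    kyFan (∑ i ∈ s, f i) m ≤ s.card * C := by
  classical
  induction s using Finset.induction_on with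
  | empty =>
    have := kyFan_le_mul_norm (H := H) (x := 0) isCompactOperator_zero m
    simpa using this
  | insert a s ha ih =>
    rw [Finset.sum_insert ha, Finset.card_insert_of_notMem ha]
    have h1 := ih (fun i hi => hf i (Finset.mem_insert_of_mem hi))
      (fun i hi => h i (Finset.mem_insert_of_mem hi))
    have h2 := h a (Finset.mem_insert_self a s)
    refine (kyFan_add_le (hf a (Finset.mem_insert_self a s))
      (isCompactOperator_sum s fun i hi => hf i (Finset.mem_insert_of_mem hi)) m).trans ?_
    refine (add_le_add h2 h1).trans_eq ?_
    push_cast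
    ring

/-- The Ky Fan norms do not increase under conjugation by a contraction. -/
theorem kyFan_conj_le (hx : IsCompactOperator x) {S : H →L[ℂ] H} (hS : ‖S‖ ≤ 1) (m : ℕ) :
    kyFan (S ∘L x ∘L ContinuousLinearMap.adjoint S) m ≤ kyFan x m := by
  -- Contractions preserve Bessel families but not orthonormal ones; this is why Ky Fan's inequality
  -- is stated for the former.
  have hB : ∀ {κ : Type u} {f : κ → H}, IsBessel f →
      IsBessel fun i => ContinuousLinearMap.adjoint S (f i) := by
    intro κ f hf s v
    simp only [ContinuousLinearMap.adjoint_inner_left]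
    refine (hf s (S v)).trans (pow_le_pow_left₀ (norm_nonneg _) ?_ 2)
    simpa using S.le_of_opNorm_le hS v
  refine kyFan_le_of_forall ((hx.comp_clm _).clm_comp S) fun κ s f e hs hf he => ?_
  refine le_trans (le_of_eq ?_) (((hB hf).sum_norm_inner_le_kyFan hx (hB he) s).trans
    (kyFan_mono x hs))
  refine Finset.sum_congr rfl fun i _ => ?_
  rw [ContinuousLinearMap.adjoint_inner_left]
  rfl

end KyFan

/-! ### Square summable families -/

theorem memℓp_two_iff {E ι : Type*} [NormedAddCommGroup E] {f : ι → E} :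
    Memℓp f 2 ↔ ∑' i, ((‖f i‖₊ ^ 2 : ℝ≥0) : ℝ≥0∞) < ∞ := by
  rw [memℓp_gen_iff (by norm_num), lt_top_iff_ne_top, ENNReal.tsum_coe_ne_top_iff_summable,
    ← NNReal.summable_coe]
  simp

/-! ### The mean ergodic theorem for contractions of pre-Hilbert spaces -/

section MeanErgodic

variable {V E : Type*} [AddCommGroup V] [Module ℂ V] [NormedAddCommGroup E]
  [InnerProductSpace ℂ E]

/-- The Cesàro averages of the powers of a linear map. -/
noncomputable def cesaro (T : Module.End ℂ V) (n : ℕ) : Module.End ℂ V :=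
  ((n : ℂ) + 1)⁻¹ • ∑ k ∈ Finset.range (n + 1), T ^ k

theorem cesaro_apply (T : Module.End ℂ V) (n : ℕ) (v : V) :
    cesaro T n v = ((n : ℂ) + 1)⁻¹ • ∑ k ∈ Finset.range (n + 1), (T ^ k) v := by
  simp [cesaro, LinearMap.sum_apply]

theorem cesaro_map_sub (T : Module.End ℂ V) (n : ℕ) (v : V) :
    cesaro T n (T v) - cesaro T n v = ((n : ℂ) + 1)⁻¹ • ((T ^ (n + 1)) v - v) := by
  rw [cesaro_apply, cesaro_apply, ← smul_sub, ← Finset.sum_sub_distrib]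
  have h := Finset.sum_range_sub (fun k => (T ^ k) v) (n + 1)
  simp only [pow_zero, Module.End.one_apply] at h
  rw [← h]
  congr 1

theorem norm_natCast_add_one (n : ℕ) : ‖((n : ℂ) + 1)‖ = (n : ℝ) + 1 := by
  have : ((n : ℂ) + 1) = ((n + 1 : ℕ) : ℂ) := by push_cast; rfl
  rw [this, Complex.norm_natCast]
  push_cast
  rfl

variable {J : V →ₗ[ℂ] E} {T : Module.End ℂ V}

theorem norm_pow_le (hT : ∀ v, ‖J (T v)‖ ≤ ‖J v‖) (k : ℕ) (v : V) : ‖J ((T ^ k) v)‖ ≤ ‖J v‖ := by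
  induction k generalizing v with
  | zero => simp
  | succ k ih =>
    rw [pow_succ, Module.End.mul_apply]
    exact (ih _).trans (hT v)

theorem norm_cesaro_le (hT : ∀ v, ‖J (T v)‖ ≤ ‖J v‖) (n : ℕ) (v : V) :
    ‖J (cesaro T n v)‖ ≤ ‖J v‖ := by
  rw [cesaro_apply, map_smul, norm_smul, norm_inv, norm_natCast_add_one, map_sum,
    inv_mul_le_iff₀ (by positivity)]
  refine (norm_sum_le_of_le _ fun k _ => norm_pow_le hT k v).trans ?_
  simp

theorem tendsto_cesaro_map_sub (hT : ∀ v, ‖J (T v)‖ ≤ ‖J v‖) (v : V) :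
    Tendsto (fun n => J (cesaro T n (T v) - cesaro T n v)) atTop (𝓝 0) := by
  refine squeeze_zero_norm (a := fun n : ℕ => (1 / ((n : ℝ) + 1)) * (2 * ‖J v‖)) (fun n => ?_) ?_
  · rw [cesaro_map_sub, map_smul, norm_smul, norm_inv, norm_natCast_add_one, map_sub, one_div]
    refine mul_le_mul_of_nonneg_left ?_ (by positivity)
    refine (norm_sub_le _ _).trans ?_
    linarith [norm_pow_le hT (n + 1) v]
  · simpa using (tendsto_one_div_add_atTop_nhds_zero_nat (𝕜 := ℝ)).mul_const (2 * ‖J v‖)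

/-- The averages of a contraction of a pre-Hilbert space form a Cauchy sequence. -/
theorem cauchySeq_cesaro (hT : ∀ v, ‖J (T v)‖ ≤ ‖J v‖) (v : V) :
    CauchySeq fun n => J (cesaro T n v) := by
  -- The vectors whose averages are asymptotic to those of `v`. They include the orbit of `v`, its
  -- averages, and midpoints; the averages of `v` will minimize the norm over this set.
  let C : Set V := {w | Tendsto (fun n => J (cesaro T n w - cesaro T n v)) atTop (𝓝 0)}
  have hpow : ∀ j, (T ^ j) v ∈ C := by
    intro j
    induction j with
    | zero => simp [C]
    | succ j ih =>
      have h := (tendsto_cesaro_map_sub hT ((T ^ j) v)).add ih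
      rw [add_zero] at h
      refine h.congr fun n => ?_
      rw [← map_add, sub_add_sub_cancel, pow_succ', Module.End.mul_apply]
  have havg : ∀ m, cesaro T m v ∈ C := by
    intro m
    have h : Tendsto (fun n => ((m : ℂ) + 1)⁻¹ • ∑ k ∈ Finset.range (m + 1),
        J (cesaro T n ((T ^ k) v) - cesaro T n v)) atTop (𝓝 0) := by
      have := (tendsto_finsetSum (Finset.range (m + 1)) fun k _ => hpow k).const_smul
        (((m : ℂ) + 1)⁻¹)
      simpa using this
    refine h.congr fun n => ?_
    have hm : ((m : ℂ) + 1) ≠ 0 := by exact_mod_cast m.succ_ne_zero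
    rw [← map_sum, Finset.sum_sub_distrib, ← map_sum, Finset.sum_const, Finset.card_range,
      ← Nat.cast_smul_eq_nsmul ℂ, ← map_smul, smul_sub, ← map_smul, ← cesaro_apply, smul_smul]
    push_cast
    rw [inv_mul_cancel₀ hm, one_smul]
  have hmid : ∀ w ∈ C, ∀ w' ∈ C, ((2 : ℂ)⁻¹) • (w + w') ∈ C := by
    intro w hw w' hw'
    have h := (hw.add hw').const_smul ((2 : ℂ)⁻¹)
    rw [add_zero, smul_zero] at h
    refine h.congr fun n => ?_
    rw [← map_add, ← map_smul]
    congr 1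
    rw [map_smul, map_add]
    module
  set d := sInf ((fun w => ‖J w‖) '' C) with hd
  have hbdd : BddBelow ((fun w => ‖J w‖) '' C) := ⟨0, by rintro _ ⟨w, -, rfl⟩; positivity⟩
  have hne : ((fun w => ‖J w‖) '' C).Nonempty := ⟨_, _, havg 0, rfl⟩
  have hdle : ∀ w ∈ C, d ≤ ‖J w‖ := fun w hw => csInf_le hbdd ⟨w, hw, rfl⟩
  have hd0 : 0 ≤ d := le_csInf hne (by rintro _ ⟨w, -, rfl⟩; positivity)
  -- The averages belong to `C`, so their norms are at least `d`. For nearly minimal `w ∈ C` they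
  -- are at most `‖J w‖ + o(1)`, as averaging is contractive.
  have hlim : Tendsto (fun n => ‖J (cesaro T n v)‖) atTop (𝓝 d) := by
    refine tendsto_order.2 ⟨fun a ha => Eventually.of_forall fun n => ha.trans_le
      (hdle _ (havg n)), fun a ha => ?_⟩
    obtain ⟨_, ⟨w, hw, rfl⟩, hwa⟩ := (csInf_lt_iff hbdd hne).1 ha
    have hw' : Tendsto (fun n => ‖J (cesaro T n w - cesaro T n v)‖) atTop (𝓝 0) := by
      simpa using (show Tendsto _ _ _ from hw).norm
    filter_upwards [hw'.eventually (gt_mem_nhds (sub_pos.2 hwa))] with n hn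
    have h1 : ‖J (cesaro T n v)‖ ≤ ‖J (cesaro T n w)‖ + ‖J (cesaro T n w - cesaro T n v)‖ := by
      rw [map_sub]
      have := norm_sub_le (J (cesaro T n w)) (J (cesaro T n w) - J (cesaro T n v))
      rwa [sub_sub_cancel] at this
    have h2 := norm_cesaro_le hT n w
    linarith
  rw [Metric.cauchySeq_iff]
  intro ε hε
  have hsq : Tendsto (fun n => ‖J (cesaro T n v)‖ ^ 2) atTop (𝓝 (d ^ 2)) := hlim.pow 2
  obtain ⟨N, hN⟩ := eventually_atTop.1 (hsq.eventually (gt_mem_nhds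
    (show d ^ 2 < d ^ 2 + ε ^ 2 / 4 by have := pow_pos hε 2; linarith)))
  refine ⟨N, fun m hm n hn => ?_⟩
  have h1 := hN m hm
  have h2 := hN n hn
  have h3 := hdle _ (hmid _ (havg m) _ (havg n))
  rw [map_smul, norm_smul, map_add] at h3
  have hhalf : ‖(2 : ℂ)⁻¹‖ = 2⁻¹ := by simp
  rw [hhalf] at h3
  -- The midpoint lies in `C`, so the sum has norm at least `2d`. Two squares below `d² + ε²/4` then
  -- leave less than `ε²` for the difference.
  have h4 := parallelogram_law_with_norm ℂ (J (cesaro T m v)) (J (cesaro T n v))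
  rw [dist_eq_norm]
  have h5 : (2 * d) ^ 2 ≤ ‖J (cesaro T m v) + J (cesaro T n v)‖ ^ 2 :=
    pow_le_pow_left₀ (by positivity) (by linarith) 2
  have h6 : ‖J (cesaro T m v) - J (cesaro T n v)‖ ^ 2 < ε ^ 2 := by nlinarith
  exact lt_of_pow_lt_pow_left₀ 2 hε.le h6

end MeanErgodic

/-! ### Dunford-Schwartz operators -/

section DunfordSchwartz

open scoped InnerProductSpace

variable {H : Type*} [NormedAddCommGroup H] [InnerProductSpace ℂ H] [CompleteSpace H]
  {T : (H →L[ℂ] H) →ₗ[ℂ] (H →L[ℂ] H)} {x y : H →L[ℂ] H}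

omit [CompleteSpace H] in
theorem average_eq_cesaro (T : (H →L[ℂ] H) →ₗ[ℂ] (H →L[ℂ] H)) (n : ℕ) (x : H →L[ℂ] H) :
    average T n x = cesaro T n x := (cesaro_apply T n x).symm

omit [CompleteSpace H] in
theorem average_add (T : (H →L[ℂ] H) →ₗ[ℂ] (H →L[ℂ] H)) (n : ℕ) (x y : H →L[ℂ] H) :
    average T n (x + y) = average T n x + average T n y := by
  simp only [average_eq_cesaro, map_add]

theorem exists_traceClass_norm_sub_lt (hx : IsCompactOperator x) {ε : ℝ} (hε : 0 < ε) :
    ∃ y ∈ traceClass H, ‖x - y‖ < ε := by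
  have h := (NNReal.tendsto_coe.2 (finiteSuperlevels_sv hx).tendsto).eventually
    (gt_mem_nhds (show ((0 : ℝ≥0) : ℝ) < ε by simpa using hε))
  obtain ⟨m, hm⟩ := h.exists
  obtain ⟨y, z, rfl, hy, hz, -⟩ := exists_decomposition hx m
  refine ⟨y, hy, lt_of_le_of_lt ?_ hm⟩
  rw [add_sub_cancel_left]
  exact hz

/-- Only trace class operators are assumed to be mapped to compact ones; norm density of the trace
class and norm closedness of the compact operators do the rest. -/
theorem IsDunfordSchwartz.isCompactOperator (hT : IsDunfordSchwartz T) (hx : IsCompactOperator x) :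
    IsCompactOperator (T x) := by
  have hcl : IsClosed {f : H →L[ℂ] H | IsCompactOperator f} := isClosed_setOfPred_isCompactOperator
  refine hcl.closure_subset_iff.2 subset_rfl ?_
  rw [Metric.mem_closure_iff]
  intro ε hε
  obtain ⟨y, hy, hxy⟩ := exists_traceClass_norm_sub_lt hx hε
  refine ⟨T y, (hT.map_traceClass y hy).1, ?_⟩
  rw [dist_eq_norm, ← map_sub]
  exact (hT.norm_le _).trans_lt hxy

/-- Dunford-Schwartz operators decrease singular values in the sense of weak majorization. -/
theorem IsDunfordSchwartz.kyFan_le (hT : IsDunfordSchwartz T) (hx : IsCompactOperator x) (m : ℕ) :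
    kyFan (T x) m ≤ kyFan x m := by
  -- The splitting is optimal for `‖y‖₁ + m ‖z‖_∞`, both terms of which `T` contracts.
  obtain ⟨y, z, rfl, hy, -, hle⟩ := exists_decomposition hx m
  have hz : IsCompactOperator z := by
    have := hx.sub hy.1
    simpa using this
  rw [map_add]
  have h1 := kyFan_add_le (hT.isCompactOperator hy.1) (hT.isCompactOperator hz) m
  have h2 : (kyFan (T y) m : ℝ≥0∞) ≤ traceNorm y :=
    (kyFan_le_traceNorm (hT.isCompactOperator hy.1) m).trans (hT.traceNorm_le y hy)
  have h3 : kyFan (T z) m ≤ m * ‖z‖₊ :=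
    (kyFan_le_mul_norm (hT.isCompactOperator hz) m).trans
      (mul_le_mul_right (show ‖T z‖₊ ≤ ‖z‖₊ from hT.norm_le z) _)
  rw [← ENNReal.coe_le_coe] at h1 h3 ⊢
  refine h1.trans (le_trans ?_ hle)
  push_cast at h3 ⊢
  exact add_le_add h2 h3

theorem IsDunfordSchwartz.pow_isCompactOperator (hT : IsDunfordSchwartz T)
    (hx : IsCompactOperator x) (k : ℕ) : IsCompactOperator ((T ^ k) x) := by
  induction k with
  | zero => simpa using hx
  | succ k ih =>
    rw [pow_succ', Module.End.mul_apply]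
    exact hT.isCompactOperator ih

theorem IsDunfordSchwartz.kyFan_pow_le (hT : IsDunfordSchwartz T)
    (hx : IsCompactOperator x) (k m : ℕ) : kyFan ((T ^ k) x) m ≤ kyFan x m := by
  induction k with
  | zero => simp
  | succ k ih =>
    rw [pow_succ', Module.End.mul_apply]
    exact (hT.kyFan_le (hT.pow_isCompactOperator hx k) m).trans ih

theorem IsDunfordSchwartz.average_isCompactOperator (hT : IsDunfordSchwartz T)
    (hx : IsCompactOperator x) (n : ℕ) : IsCompactOperator (average T n x) :=
  (isCompactOperator_sum _ fun k _ => hT.pow_isCompactOperator hx k).smul (((n : ℂ) + 1)⁻¹)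

theorem IsDunfordSchwartz.kyFan_average_le (hT : IsDunfordSchwartz T)
    (hx : IsCompactOperator x) (n m : ℕ) : kyFan (average T n x) m ≤ kyFan x m := by
  refine (kyFan_smul_le (isCompactOperator_sum _ fun k _ => hT.pow_isCompactOperator hx k)
    _ m).trans ?_
  have h := kyFan_sum_le (Finset.range (n + 1)) (fun k _ => hT.pow_isCompactOperator hx k)
    (fun k _ => hT.kyFan_pow_le hx k m)
  have hn : ‖((n : ℂ) + 1)⁻¹‖₊ = ((n : ℝ≥0) + 1)⁻¹ := by
    ext
    rw [coe_nnnorm, norm_inv, norm_natCast_add_one]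
    push_cast
    rfl
  rw [hn, inv_mul_le_iff₀ (by positivity)]
  simpa using h

theorem IsDunfordSchwartz.norm_average_le (hT : IsDunfordSchwartz T) (x : H →L[ℂ] H) (n : ℕ) :
    ‖average T n x‖ ≤ ‖x‖ := by
  have hpow : ∀ k, ‖(T ^ k) x‖ ≤ ‖x‖ := by
    intro k
    induction k with
    | zero => simp
    | succ k ih =>
      rw [pow_succ', Module.End.mul_apply]
      exact (hT.norm_le _).trans ih
  rw [average, norm_smul, norm_inv, norm_natCast_add_one, inv_mul_le_iff₀ (by positivity)]
  refine (norm_sum_le_of_le _ fun k _ => hpow k).trans ?_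
  simp

/-! ### Hilbert-Schmidt operators -/

theorem tsum_nnnorm_apply_sq_eq (hx : IsCompactOperator x) {ι : Type*} (φ : HilbertBasis ι ℂ H) :
    ∑' i, ((‖x (φ i)‖₊ ^ 2 : ℝ≥0) : ℝ≥0∞) = ∑' k, ((sv x k ^ 2 : ℝ≥0) : ℝ≥0∞) := by
  obtain ⟨κ, b, lam, h⟩ := exists_isEigenbasis hx
  have habs : ∀ v, ‖CFC.abs x v‖₊ = ‖x v‖₊ := fun v => NNReal.eq (norm_abs_apply x v)
  have h1 := tsum_nnnorm_sq_eq (abs_inner_left x) φ b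
  simp only [habs, h.norm_apply] at h1
  rw [h1]
  exact ((h.equimeasurable_sv hx).comp (Φ := fun u => u ^ 2) (fun _ _ huv => pow_le_pow_left₀ zero_le huv 2)
    (by simp) fun u => (continuous_pow 2).continuousWithinAt).tsum_eq

theorem convexOn_sq_nnreal : ConvexOn ℝ≥0 Set.univ fun u : ℝ≥0 => u ^ 2 := by
  refine ⟨convex_univ, fun x _ y _ a b _ _ hab => ?_⟩
  have hab' : (a : ℝ) + b = 1 := by exact_mod_cast hab
  have h := (even_two.convexOn_pow (𝕜 := ℝ)).2 (Set.mem_univ (x : ℝ)) (Set.mem_univ (y : ℝ))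
    a.2 b.2 hab'
  exact_mod_cast h

/-- The compact operators that are Hilbert-Schmidt with respect to the Hilbert basis `φ`. -/
def hilbertSchmidt {ι : Type*} (φ : HilbertBasis ι ℂ H) : Submodule ℂ (H →L[ℂ] H) where
  carrier := {x | IsCompactOperator x ∧ Memℓp (fun i => x (φ i)) 2}
  add_mem' hx hy := ⟨hx.1.add hy.1, hx.2.add hy.2⟩
  zero_mem' := ⟨isCompactOperator_zero, zero_memℓp⟩
  smul_mem' c _ hx := ⟨hx.1.smul c, hx.2.const_smul c⟩

/-- The embedding of the Hilbert-Schmidt operators into a Hilbert space of square summable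
families. -/
noncomputable def hilbertSchmidtEmbedding {ι : Type*} (φ : HilbertBasis ι ℂ H) :
    hilbertSchmidt φ →ₗ[ℂ] lp (fun _ : ι => H) 2 where
  toFun x := ⟨fun i => (x : H →L[ℂ] H) (φ i), x.2.2⟩
  map_add' _ _ := rfl
  map_smul' _ _ := rfl

theorem ofReal_norm_hilbertSchmidtEmbedding_sq {ι : Type*} (φ : HilbertBasis ι ℂ H)
    (x : hilbertSchmidt φ) :
    ENNReal.ofReal (‖hilbertSchmidtEmbedding φ x‖ ^ 2) =
      ∑' k, ((sv (x : H →L[ℂ] H) k ^ 2 : ℝ≥0) : ℝ≥0∞) := by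
  rw [← tsum_nnnorm_apply_sq_eq x.2.1 φ]
  have h := lp.hasSum_norm (p := 2) (by norm_num) (hilbertSchmidtEmbedding φ x)
  simp only [ENNReal.toReal_ofNat, Real.rpow_ofNat] at h
  have h2 : HasSum (fun i => ‖(x : H →L[ℂ] H) (φ i)‖₊ ^ 2) (‖hilbertSchmidtEmbedding φ x‖₊ ^ 2) := by
    rw [← NNReal.hasSum_coe]
    push_cast
    exact h
  rw [(ENNReal.hasSum_coe.2 h2).tsum_eq, ← ENNReal.ofReal_coe_nnreal]
  simp

theorem norm_le_norm_hilbertSchmidtEmbedding {ι : Type*} (φ : HilbertBasis ι ℂ H)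
    (x : hilbertSchmidt φ) : ‖(x : H →L[ℂ] H)‖ ≤ ‖hilbertSchmidtEmbedding φ x‖ := by
  have h1 : ((sv (x : H →L[ℂ] H) 0 ^ 2 : ℝ≥0) : ℝ≥0∞) ≤ _ :=
    ENNReal.le_tsum (f := fun k => ((sv (x : H →L[ℂ] H) k ^ 2 : ℝ≥0) : ℝ≥0∞)) 0
  rw [← ofReal_norm_hilbertSchmidtEmbedding_sq, sv_zero_eq x.2.1, ← ENNReal.ofReal_coe_nnreal,
    ENNReal.ofReal_le_ofReal_iff (by positivity)] at h1
  exact le_of_sq_le_sq (by simpa using h1) (norm_nonneg _)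

theorem traceClass_subset_hilbertSchmidt {ι : Type*} (φ : HilbertBasis ι ℂ H)
    (hx : x ∈ traceClass H) : x ∈ hilbertSchmidt φ := by
  refine ⟨hx.1, memℓp_two_iff.2 ?_⟩
  rw [tsum_nnnorm_apply_sq_eq hx.1]
  have htr := hx.2
  rw [traceNorm_eq_tsum_sv hx.1] at htr
  calc ∑' k, ((sv x k ^ 2 : ℝ≥0) : ℝ≥0∞) ≤ ∑' k, (sv x 0 : ℝ≥0∞) * sv x k := by
        refine ENNReal.tsum_le_tsum fun k => ?_
        rw [← ENNReal.coe_mul, ENNReal.coe_le_coe, sq]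
        exact mul_le_mul_left (sv_antitone hx.1 (Nat.zero_le k)) _
    _ = sv x 0 * ∑' k, (sv x k : ℝ≥0∞) := ENNReal.tsum_mul_left
    _ < ∞ := ENNReal.mul_lt_top ENNReal.coe_lt_top htr

/-- Interpolation between the trace norm and the operator norm, in the form of majorization for `u ↦
u²`: it makes `T` a Hilbert–Schmidt contraction. -/
theorem IsDunfordSchwartz.tsum_sv_sq_le (hT : IsDunfordSchwartz T) (hx : IsCompactOperator x) :
    ∑' k, ((sv (T x) k ^ 2 : ℝ≥0) : ℝ≥0∞) ≤ ∑' k, ((sv x k ^ 2 : ℝ≥0) : ℝ≥0∞) :=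
  tsum_le_tsum_of_majorized convexOn_sq_nnreal (fun _ _ huv => pow_le_pow_left₀ zero_le huv 2)
    (sv_antitone (hT.isCompactOperator hx)) (hT.kyFan_le hx)

theorem IsDunfordSchwartz.mapsTo_hilbertSchmidt (hT : IsDunfordSchwartz T) {ι : Type*}
    (φ : HilbertBasis ι ℂ H) : ∀ x ∈ hilbertSchmidt φ, T x ∈ hilbertSchmidt φ := by
  intro x hx
  refine ⟨hT.isCompactOperator hx.1, memℓp_two_iff.2 ?_⟩
  rw [tsum_nnnorm_apply_sq_eq (hT.isCompactOperator hx.1)]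
  refine (hT.tsum_sv_sq_le hx.1).trans_lt ?_
  rw [← tsum_nnnorm_apply_sq_eq hx.1 φ]
  exact memℓp_two_iff.1 hx.2

theorem IsDunfordSchwartz.cauchySeq_average_of_mem_hilbertSchmidt (hT : IsDunfordSchwartz T)
    {ι : Type*} (φ : HilbertBasis ι ℂ H) (hx : x ∈ hilbertSchmidt φ) :
    CauchySeq fun n => average T n x := by
  let S : Module.End ℂ (hilbertSchmidt φ) := T.restrict (hT.mapsTo_hilbertSchmidt φ)
  have hS : ∀ v, ‖hilbertSchmidtEmbedding φ (S v)‖ ≤ ‖hilbertSchmidtEmbedding φ v‖ := by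
    intro v
    have h := hT.tsum_sv_sq_le v.2.1
    have h1 := ofReal_norm_hilbertSchmidtEmbedding_sq φ (S v)
    have h2 : ((S v : hilbertSchmidt φ) : H →L[ℂ] H) = T v := rfl
    rw [h2] at h1
    rw [← h1, ← ofReal_norm_hilbertSchmidtEmbedding_sq,
      ENNReal.ofReal_le_ofReal_iff (by positivity)] at h
    exact le_of_sq_le_sq h (norm_nonneg _)
  have hpow : ∀ (k : ℕ) (v : hilbertSchmidt φ),
      (((S ^ k) v : hilbertSchmidt φ) : H →L[ℂ] H) = (T ^ k) v := by
    intro k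
    induction k with
    | zero => intro v; rfl
    | succ k ih =>
      intro v
      rw [pow_succ, pow_succ, Module.End.mul_apply, Module.End.mul_apply, ih]
      rfl
  have hces : ∀ n, ((cesaro S n ⟨x, hx⟩ : hilbertSchmidt φ) : H →L[ℂ] H) = average T n x := by
    intro n
    rw [cesaro_apply, Submodule.coe_smul, Submodule.coe_sum, average]
    simp only [hpow]
  have hc := cauchySeq_cesaro hS ⟨x, hx⟩
  rw [Metric.cauchySeq_iff] at hc ⊢
  intro ε hε
  obtain ⟨N, hN⟩ := hc ε hε
  refine ⟨N, fun m hm n hn => lt_of_le_of_lt ?_ (hN m hm n hn)⟩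
  rw [dist_eq_norm, dist_eq_norm, ← hces, ← hces, ← map_sub, ← Submodule.coe_sub]
  exact norm_le_norm_hilbertSchmidtEmbedding φ _

theorem IsDunfordSchwartz.cauchySeq_average (hT : IsDunfordSchwartz T) (hx : IsCompactOperator x) :
    CauchySeq fun n => average T n x := by
  obtain ⟨w, φ, -⟩ := exists_hilbertBasis ℂ H
  rw [Metric.cauchySeq_iff]
  intro ε hε
  obtain ⟨y, hy, hxy⟩ := exists_traceClass_norm_sub_lt hx (show 0 < ε / 3 by positivity)
  obtain ⟨N, hN⟩ := Metric.cauchySeq_iff.1 (hT.cauchySeq_average_of_mem_hilbertSchmidt φ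
    (traceClass_subset_hilbertSchmidt φ hy)) (ε / 3) (by positivity)
  have hclose : ∀ n, dist (average T n x) (average T n y) < ε / 3 := by
    intro n
    have h : average T n x - average T n y = average T n (x - y) := by
      simp only [average_eq_cesaro, map_sub]
    rw [dist_eq_norm, h]
    exact (hT.norm_average_le _ n).trans_lt hxy
  refine ⟨N, fun m hm n hn => ?_⟩
  calc dist (average T m x) (average T n x)
      ≤ dist (average T m x) (average T m y) + dist (average T m y) (average T n y) +
        dist (average T n y) (average T n x) := dist_triangle4 _ _ _ _
    _ < ε / 3 + ε / 3 + ε / 3 := by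
        rw [dist_comm (average T n y)]
        exact add_lt_add (add_lt_add (hclose m) (hN m hm n hn)) (hclose n)
    _ = ε := by ring

/-- The `m`-th Ky Fan sum is `m`-Lipschitz for the operator norm. -/
theorem kyFan_le_of_tendsto {f : ℕ → H →L[ℂ] H} (hf : ∀ n, IsCompactOperator (f n))
    (hy : IsCompactOperator y) (h : Tendsto f atTop (𝓝 y)) {C : ℝ≥0} {m : ℕ}
    (hC : ∀ n, kyFan (f n) m ≤ C) : kyFan y m ≤ C := by
  have h1 : Tendsto (fun n => C + m * ‖y - f n‖₊) atTop (𝓝 (C + m * ‖y - y‖₊)) :=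
    ((tendsto_const_nhds.sub h).nnnorm.const_mul _).const_add _
  rw [sub_self, nnnorm_zero, mul_zero, add_zero] at h1
  refine ge_of_tendsto' h1 fun n => ?_
  have hc : IsCompactOperator (y - f n : H →L[ℂ] H) := hy.sub (hf n)
  have h2 := kyFan_add_le (hf n) hc m
  rw [show f n + (y - f n) = y by abel] at h2
  exact h2.trans (add_le_add (hC n) (kyFan_le_mul_norm hc m))

/-- The averages of a compact operator converge in norm, and the limit is weakly majorized by the
operator. -/
theorem IsDunfordSchwartz.exists_tendsto_average (hT : IsDunfordSchwartz T)
    (hx : IsCompactOperator x) :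
    ∃ y : H →L[ℂ] H, IsCompactOperator y ∧ (∀ m, kyFan y m ≤ kyFan x m) ∧
      Tendsto (fun n => average T n x) atTop (𝓝 y) := by
  obtain ⟨y, hy⟩ := cauchySeq_tendsto_of_complete (hT.cauchySeq_average hx)
  have hyc : IsCompactOperator y := isCompactOperator_of_tendsto hy
    (Eventually.of_forall fun n => hT.average_isCompactOperator hx n)
  exact ⟨y, hyc, fun m => kyFan_le_of_tendsto (fun n => hT.average_isCompactOperator hx n) hyc hy
    fun n => hT.kyFan_average_le hx n m, hy⟩

end DunfordSchwartz

/-! ### Orlicz functions -/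

section OrliczFunction

variable {Φ : ℝ≥0 → ℝ≥0}

/-- The condition only controls small arguments, but all except finitely many entries are small. -/
theorem DeltaTwoAtZero.tsum_two_mul_lt_top (h : DeltaTwoAtZero Φ) (h0 : Φ 0 = 0) {ι : Type*}
    {f : ι → ℝ≥0} (hf : FiniteSuperlevels f) (hsum : ∑' i, (Φ (f i) : ℝ≥0∞) < ∞) :
    ∑' i, (Φ (2 * f i) : ℝ≥0∞) < ∞ := by
  classical
  obtain ⟨u₀, hu₀, k, -, hk⟩ := h
  let s : Finset ι := (hf (u₀ / 2) (half_pos hu₀)).toFinset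
  have hle : ∀ i, (Φ (2 * f i) : ℝ≥0∞) ≤ k * Φ (f i) + if i ∈ s then (Φ (2 * f i) : ℝ≥0∞) else 0 := by
    intro i
    by_cases hi : i ∈ s
    · rw [if_pos hi]; exact le_add_self
    · rw [if_neg hi, add_zero]
      have hlt : f i < u₀ := by
        have : ¬ u₀ / 2 < f i := by simpa [s] using hi
        exact (not_lt.1 this).trans_lt (half_lt_self hu₀)
      rcases eq_or_ne (f i) 0 with hz | hz
      · simp [hz, h0]
      · exact_mod_cast (hk (f i) (pos_iff_ne_zero.2 hz) hlt).le
  refine (ENNReal.tsum_le_tsum hle).trans_lt ?_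
  rw [ENNReal.tsum_add, ENNReal.tsum_mul_left, tsum_eq_sum (s := s) fun i hi => if_neg hi]
  refine ENNReal.add_lt_top.2 ⟨ENNReal.mul_lt_top ENNReal.coe_lt_top hsum, ?_⟩
  refine ENNReal.sum_lt_top.2 fun i hi => ?_
  rw [if_pos hi]
  exact ENNReal.coe_lt_top

theorem FiniteSuperlevels.const_mul {ι : Type*} {f : ι → ℝ≥0} (hf : FiniteSuperlevels f)
    {c : ℝ≥0} (hc : 0 < c) : FiniteSuperlevels fun i => c * f i := by
  intro t ht
  refine (hf (t / c) (div_pos ht hc)).subset fun i hi => ?_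
  have hi' : t < c * f i := hi
  change t / c < f i
  rwa [div_lt_iff₀' hc]

/-- Under the `Δ₂`-condition, the modular is finite at all scales once it is at one. -/
theorem DeltaTwoAtZero.tsum_div_lt_top (h : DeltaTwoAtZero Φ) (h0 : Φ 0 = 0) (hm : Monotone Φ)
    {ι : Type*} {f : ι → ℝ≥0} (hf : FiniteSuperlevels f) {a₀ : ℝ≥0} (ha₀ : 0 < a₀)
    (hsum : ∑' i, (Φ (f i / a₀) : ℝ≥0∞) < ∞) {a : ℝ≥0} (ha : 0 < a) :
    ∑' i, (Φ (f i / a) : ℝ≥0∞) < ∞ := by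
  have hpow : ∀ j : ℕ, ∑' i, (Φ (2 ^ j * (f i / a₀)) : ℝ≥0∞) < ∞ := by
    intro j
    induction j with
    | zero => simpa using hsum
    | succ j ih =>
      have hfs : FiniteSuperlevels fun i => 2 ^ j * (f i / a₀) := by
        have := hf.const_mul (c := 2 ^ j * a₀⁻¹) (by positivity)
        simpa only [div_eq_mul_inv, mul_comm (f _), mul_assoc] using this
      have := h.tsum_two_mul_lt_top h0 hfs ih
      simpa only [pow_succ', mul_assoc] using this
  obtain ⟨j, hj⟩ := pow_unbounded_of_one_lt (a₀ / a) (one_lt_two (α := ℝ≥0))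
  refine (ENNReal.tsum_le_tsum fun i => ?_).trans_lt (hpow j)
  refine ENNReal.coe_le_coe.2 (hm ?_)
  rw [div_lt_iff₀ ha] at hj
  rw [div_le_iff₀ ha, mul_div_assoc', div_mul_eq_mul_div, le_div_iff₀ ha₀]
  calc f i * a₀ ≤ f i * (2 ^ j * a) := by gcongr
    _ = 2 ^ j * f i * a := by ring

theorem exists_le_mul_of_tendsto (h0 : Φ 0 = 0)
    (hlim : Tendsto (fun u : ℝ≥0 => Φ u / u) (𝓝[≠] 0) (𝓝 0)) {η : ℝ≥0} (hη : 0 < η) :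
    ∃ δ : ℝ≥0, 0 < δ ∧ ∀ u < δ, Φ u ≤ η * u := by
  have h := hlim.eventually (gt_mem_nhds hη)
  rw [eventually_nhdsWithin_iff] at h
  obtain ⟨δ, hδ, hsub⟩ := (NNReal.nhds_zero_basis.eventually_iff).1 h
  refine ⟨δ, hδ, fun u hu => ?_⟩
  rcases eq_or_ne u 0 with rfl | hne
  · simp [h0]
  · have := hsub hu hne
    exact ((div_lt_iff₀ (pos_iff_ne_zero.2 hne)).1 this).le

end OrliczFunction

/-! ### The Orlicz ideals -/

section OrliczIdeal

variable {H : Type*} [NormedAddCommGroup H] [InnerProductSpace ℂ H] [CompleteSpace H]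
  {Φ : ℝ≥0 → ℝ≥0} {x y : H →L[ℂ] H}

theorem modular_eq_tsum_sv (hx : IsCompactOperator x) (a : ℝ≥0) :
    modular Φ (singularSeq x) a = ∑' k, (Φ (sv x k / a) : ℝ≥0∞) := by
  simp only [modular, nnnorm_singularSeq hx]

theorem IsEigenbasis.modular_eq (hΦ : IsOrliczFunction Φ) (hx : IsCompactOperator x) {ι : Type*}
    {b : HilbertBasis ι ℂ H} {lam : ι → ℝ≥0} (h : IsEigenbasis x b lam) {a : ℝ≥0} (ha : 0 < a) :
    modular Φ (singularSeq x) a = ∑' i, (Φ (lam i / a) : ℝ≥0∞) := by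
  rw [modular_eq_tsum_sv hx]
  exact ((((h.equimeasurable_sv hx).div ha).comp hΦ.monotone hΦ.map_zero
    hΦ.leftContinuous).tsum_eq).symm

theorem mem_orliczIdeal_iff : x ∈ orliczIdeal H Φ ↔
    IsCompactOperator x ∧ ∃ a : ℝ≥0, 0 < a ∧ modular Φ (singularSeq x) a < ∞ := by
  refine ⟨fun h => ⟨h.1, h.2.2⟩, fun h => ⟨h.1, ?_, h.2⟩⟩
  refine memℓp_infty ⟨sv x 0, ?_⟩
  rintro _ ⟨n, rfl⟩
  have := nnnorm_singularSeq h.1 n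
  change ‖singularSeq x n‖ ≤ sv x 0
  rw [← coe_nnnorm, this]
  exact_mod_cast sv_antitone h.1 (Nat.zero_le n)

theorem antitone_div {r : ℕ → ℝ≥0} (hr : Antitone r) (a : ℝ≥0) : Antitone fun k => r k / a := by
  intro i j hij
  exact div_le_div_of_nonneg_right (hr hij) zero_le

/-- Every passage from Ky Fan bounds to membership in the ideal goes through this: after rescaling
by `c`, the hypothesis is weak majorization. -/
theorem modular_le_of_kyFan_le_mul (hΦ : IsOrliczFunction Φ) (hx : IsCompactOperator x)
    (hy : IsCompactOperator y) {c : ℝ≥0} (hc : 0 < c) (h : ∀ m, kyFan y m ≤ c * kyFan x m)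
    (a : ℝ≥0) : modular Φ (singularSeq y) (c * a) ≤ modular Φ (singularSeq x) a := by
  rw [modular_eq_tsum_sv hx, modular_eq_tsum_sv hy]
  refine tsum_le_tsum_of_majorized hΦ.convex hΦ.monotone (antitone_div (sv_antitone hy) _)
    fun m => ?_
  rw [← Finset.sum_div, ← Finset.sum_div, ← div_div]
  refine div_le_div_of_nonneg_right ?_ zero_le
  rw [div_le_iff₀' hc]
  exact h m

/-- A substitute for the triangle inequality of the Luxemburg norm: subadditivity of the Ky Fan sums
gives majorization by the mean of the two sequences, and convexity splits the mean. -/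
theorem modular_add_le (hΦ : IsOrliczFunction Φ) (hx : IsCompactOperator x)
    (hy : IsCompactOperator y) (a : ℝ≥0) :
    modular Φ (singularSeq (x + y)) (2 * a) ≤
      2⁻¹ * (modular Φ (singularSeq x) a + modular Φ (singularSeq y) a) := by
  have hxy : IsCompactOperator (x + y : H →L[ℂ] H) := hx.add hy
  rw [modular_eq_tsum_sv hxy, modular_eq_tsum_sv hx, modular_eq_tsum_sv hy, ← ENNReal.tsum_add,
    ← ENNReal.tsum_mul_left]
  have hhalf : (2⁻¹ : ℝ≥0) + 2⁻¹ = 1 := by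
    rw [← two_mul]; exact mul_inv_cancel₀ two_ne_zero
  refine (tsum_le_tsum_of_majorized hΦ.convex hΦ.monotone (antitone_div (sv_antitone hxy) _)
    (s := fun k => (2⁻¹ : ℝ≥0) • (sv x k / a) + (2⁻¹ : ℝ≥0) • (sv y k / a)) fun m => ?_).trans
    (ENNReal.tsum_le_tsum fun k => ?_)
  · simp only [smul_eq_mul, Finset.sum_add_distrib, ← Finset.mul_sum, ← Finset.sum_div]
    rw [← mul_add, ← add_div, ← div_div, div_eq_mul_inv _ (2 : ℝ≥0), mul_comm _ (2⁻¹ : ℝ≥0),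
      mul_div_assoc]
    exact mul_le_mul_right (div_le_div_of_nonneg_right (kyFan_add_le hx hy m) zero_le) _
  · have h := hΦ.convex.2 (Set.mem_univ (sv x k / a)) (Set.mem_univ (sv y k / a))
      (zero_le (a := (2⁻¹ : ℝ≥0))) (zero_le (a := (2⁻¹ : ℝ≥0))) hhalf
    refine (ENNReal.coe_le_coe.2 h).trans_eq ?_
    rw [smul_eq_mul, smul_eq_mul, ← mul_add, ENNReal.coe_mul, ENNReal.coe_add,
      ENNReal.coe_inv two_ne_zero]
    rfl

theorem orliczNorm_le {a : ℝ≥0} (ha : 0 < a) (h : modular Φ (singularSeq x) a ≤ 1) :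
    orliczNorm Φ x ≤ a := by
  rw [orliczNorm, luxemburgNorm, NNReal.coe_le_coe]
  exact csInf_le (OrderBot.bddBelow _) ⟨ha, h⟩

theorem orliczNorm_nonneg (Φ : ℝ≥0 → ℝ≥0) (x : H →L[ℂ] H) : 0 ≤ orliczNorm Φ x :=
  NNReal.coe_nonneg _

theorem mem_orliczIdeal_of_kyFan_le_mul (hΦ : IsOrliczFunction Φ) (hx : x ∈ orliczIdeal H Φ)
    (hy : IsCompactOperator y) {c : ℝ≥0} (hc : 0 < c) (h : ∀ m, kyFan y m ≤ c * kyFan x m) :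
    y ∈ orliczIdeal H Φ := by
  obtain ⟨hxc, a, ha, hlt⟩ := mem_orliczIdeal_iff.1 hx
  exact mem_orliczIdeal_iff.2 ⟨hy, c * a, mul_pos hc ha,
    (modular_le_of_kyFan_le_mul hΦ hxc hy hc h a).trans_lt hlt⟩

variable {T : (H →L[ℂ] H) →ₗ[ℂ] (H →L[ℂ] H)}

theorem IsDunfordSchwartz.kyFan_average_sub_le (hT : IsDunfordSchwartz T)
    (hx : IsCompactOperator x) (hy : IsCompactOperator y) (h : ∀ m, kyFan y m ≤ kyFan x m)
    (n m : ℕ) : kyFan (average T n x - y) m ≤ 2 * kyFan x m := by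
  refine (kyFan_sub_le (hT.average_isCompactOperator hx n) hy m).trans ?_
  rw [two_mul]
  exact add_le_add (hT.kyFan_average_le hx n m) (h m)

/-- The individual ergodic theorem. -/
theorem individualErgodicTheorem_orliczIdeal (hΦ : IsOrliczFunction Φ) :
    IndividualErgodicTheorem (orliczIdeal H Φ) := by
  intro x hx T hT
  obtain ⟨y, hy, hle, hlim⟩ := hT.exists_tendsto_average hx.1
  exact ⟨y, mem_orliczIdeal_of_kyFan_le_mul hΦ hx hy one_pos (by simpa using hle),
    tendsto_iff_norm_sub_tendsto_zero.1 hlim⟩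

/-- If `Φ(u) / u → 0`, the averages of a trace class operator converge in the Orlicz norm. -/
theorem IsDunfordSchwartz.eventually_modular_le_one (hΦ : IsOrliczFunction Φ)
    (hlim : Tendsto (fun u : ℝ≥0 => Φ u / u) (𝓝[≠] 0) (𝓝 0)) (hT : IsDunfordSchwartz T)
    (hx : x ∈ traceClass H) (hy : IsCompactOperator y) (hle : ∀ m, kyFan y m ≤ kyFan x m)
    (hxy : Tendsto (fun n => average T n x) atTop (𝓝 y)) {c : ℝ≥0} (hc : 0 < c) :
    ∀ᶠ n in atTop, modular Φ (singularSeq (average T n x - y)) c ≤ 1 := by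
  have hcomp : ∀ n, IsCompactOperator (average T n x - y : H →L[ℂ] H) := fun n =>
    (hT.average_isCompactOperator hx.1 n).sub hy
  -- A bound, uniform in `n`, for the trace norm of the difference. With slope `c / (M + 1)`, each
  -- term `Φ(s / c)` is at most `s / (M + 1)`, and the sum is at most `M / (M + 1)`.
  set M : ℝ≥0 := 2 * (traceNorm x).toNNReal with hM
  have hsum : ∀ n, ∑' k, (sv (average T n x - y) k : ℝ≥0∞) ≤ M := by
    intro n
    rw [← traceNorm_eq_tsum_sv (hcomp n)]
    refine traceNorm_le_of_kyFan_le (hcomp n) fun m => ?_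
    have h1 := kyFan_le_traceNorm hx.1 m
    rw [← ENNReal.coe_toNNReal hx.2.ne, ENNReal.coe_le_coe] at h1
    exact ENNReal.coe_le_coe.2 ((hT.kyFan_average_sub_le hx.1 hy hle n m).trans
      (mul_le_mul_right h1 2))
  obtain ⟨δ, hδ, hΦδ⟩ := exists_le_mul_of_tendsto hΦ.map_zero hlim
    (η := c / (M + 1)) (by positivity)
  have hnorm : Tendsto (fun n => ‖average T n x - y‖₊) atTop (𝓝 0) := by
    simpa using (hxy.sub (tendsto_const_nhds (x := y))).nnnorm
  filter_upwards [hnorm.eventually (gt_mem_nhds (mul_pos hc hδ))] with n hn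
  rw [modular_eq_tsum_sv (hcomp n)]
  have hterm : ∀ k, (Φ (sv (average T n x - y) k / c) : ℝ≥0∞) ≤
      ((M + 1)⁻¹ : ℝ≥0) * sv (average T n x - y) k := by
    intro k
    rw [← ENNReal.coe_mul, ENNReal.coe_le_coe]
    have hlt : sv (average T n x - y) k / c < δ := by
      rw [div_lt_iff₀' hc]
      refine lt_of_le_of_lt (sv_antitone (hcomp n) (Nat.zero_le k)) ?_
      rwa [sv_zero_eq (hcomp n)]
    refine (hΦδ _ hlt).trans_eq ?_
    field_simp
  refine (ENNReal.tsum_le_tsum hterm).trans ?_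
  rw [ENNReal.tsum_mul_left]
  refine (mul_le_mul_right (hsum n) _).trans ?_
  rw [← ENNReal.coe_mul, ← ENNReal.coe_one, ENNReal.coe_le_coe, inv_mul_le_iff₀ (by positivity),
    mul_one]
  exact le_self_add

/-- Under the `Δ₂`-condition, finite rank operators are dense in the Orlicz ideal. -/
theorem DeltaTwoAtZero.exists_traceClass_add (hΦ : IsOrliczFunction Φ) (hΔ : DeltaTwoAtZero Φ)
    (hx : x ∈ orliczIdeal H Φ) {a : ℝ≥0} (ha : 0 < a) :
    ∃ u v : H →L[ℂ] H, x = u + v ∧ u ∈ traceClass H ∧ IsCompactOperator v ∧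
      modular Φ (singularSeq v) a ≤ 1 := by
  classical
  obtain ⟨hxc, a₀, ha₀, hlt⟩ := mem_orliczIdeal_iff.1 hx
  obtain ⟨ι, b, lam, h⟩ := exists_isEigenbasis hxc
  rw [h.modular_eq hΦ hxc ha₀] at hlt
  have hfin := hΔ.tsum_div_lt_top hΦ.map_zero hΦ.monotone (h.finiteSuperlevels hxc) ha₀ hlt ha
  -- Finiteness at the prescribed scale `a`, supplied by `Δ₂`, makes a tail smaller than `1`; `x` is
  -- cut along the finite set `s`.
  obtain ⟨s, hs⟩ := ((ENNReal.tendsto_tsum_compl_atTop_zero hfin.ne).eventually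
    (gt_mem_nhds one_pos)).exists
  let d : ι → ℝ≥0 := fun i => if i ∈ s then 1 else 0
  let d' : ι → ℝ≥0 := fun i => if i ∈ s then 0 else 1
  have hd : ∀ i, d i ≤ 1 := fun i => by simp only [d]; split_ifs <;> simp
  have hd' : ∀ i, d' i ≤ 1 := fun i => by simp only [d']; split_ifs <;> simp
  have hone : diagonalOp b d + diagonalOp b d' = ContinuousLinearMap.id ℂ H := by
    refine ext_hilbertBasis b fun i => ?_
    rw [add_apply, diagonalOp_apply b hd, diagonalOp_apply b hd', ContinuousLinearMap.id_apply]
    by_cases hi : i ∈ s <;> simp [d, d', hi]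
  refine ⟨x ∘L diagonalOp b d, x ∘L diagonalOp b d', ?_, ⟨hxc.comp_clm _, ?_⟩,
    hxc.comp_clm _, ?_⟩
  · rw [← ContinuousLinearMap.comp_add, hone, ContinuousLinearMap.comp_id]
  · rw [(h.comp_diagonalOp hd).traceNorm_eq, tsum_eq_sum (s := s) fun i hi => by simp [d, hi]]
    exact ENNReal.sum_lt_top.2 fun i _ => ENNReal.coe_lt_top
  · rw [(h.comp_diagonalOp hd').modular_eq hΦ (hxc.comp_clm _) ha]
    refine le_trans (le_of_eq ?_) hs.le
    refine Eq.trans ?_ (tsum_subtype {i | i ∉ s} fun i => (Φ (lam i / a) : ℝ≥0∞)).symm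
    refine tsum_congr fun i => ?_
    by_cases hi : i ∈ s <;> simp [d', hi, hΦ.map_zero]

/-- The mean ergodic theorem under the `Δ₂`-condition and `Φ(u) / u → 0`. -/
theorem meanErgodicTheorem_orliczIdeal (hΦ : IsOrliczFunction Φ) (hΔ : DeltaTwoAtZero Φ)
    (hlim : Tendsto (fun u : ℝ≥0 => Φ u / u) (𝓝[≠] 0) (𝓝 0)) :
    MeanErgodicTheorem (orliczIdeal H Φ) (orliczNorm Φ) := by
  intro x hx T hT
  obtain ⟨y, hy, hle, hxy⟩ := hT.exists_tendsto_average hx.1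
  refine ⟨y, mem_orliczIdeal_of_kyFan_le_mul hΦ hx hy one_pos (by simpa using hle),
    fun n => mem_orliczIdeal_of_kyFan_le_mul hΦ hx
      ((hT.average_isCompactOperator hx.1 n).sub hy) two_pos
      (hT.kyFan_average_sub_le hx.1 hy hle n), ?_⟩
  refine tendsto_order.2 ⟨fun ε hε => Eventually.of_forall fun n =>
    hε.trans_le (orliczNorm_nonneg _ _), fun ε hε => ?_⟩
  -- The scale doubles twice: the Ky Fan sums of `Aₙ v - yv` are at most twice those of `v`, and
  -- adding the two parts costs another factor `2`.
  obtain ⟨a, ha, haε⟩ : ∃ a : ℝ≥0, 0 < a ∧ ((2 * (2 * a) : ℝ≥0) : ℝ) < ε := by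
    refine ⟨(ε / 8).toNNReal, by simpa using hε, ?_⟩
    push_cast
    rw [Real.coe_toNNReal _ (by positivity)]
    linarith
  obtain ⟨u, v, rfl, hu, hv, hva⟩ := hΔ.exists_traceClass_add hΦ hx ha
  obtain ⟨yu, hyu, hleu, hlimu⟩ := hT.exists_tendsto_average hu.1
  obtain ⟨yv, hyv, hlev, hlimv⟩ := hT.exists_tendsto_average hv
  have hy_eq : y = yu + yv := by
    refine tendsto_nhds_unique hxy ?_
    simp only [average_add]
    exact hlimu.add hlimv
  filter_upwards [hT.eventually_modular_le_one hΦ hlim hu hyu hleu hlimu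
    (c := 2 * a) (by positivity)] with n hn
  refine lt_of_le_of_lt (orliczNorm_le (a := 2 * (2 * a)) (by positivity) ?_) haε
  have hcu : IsCompactOperator (average T n u - yu : H →L[ℂ] H) :=
    (hT.average_isCompactOperator hu.1 n).sub hyu
  have hcv : IsCompactOperator (average T n v - yv : H →L[ℂ] H) :=
    (hT.average_isCompactOperator hv n).sub hyv
  have hsplit : average T n (u + v) - y = (average T n u - yu) + (average T n v - yv) := by
    rw [hy_eq, average_add]; abel
  rw [hsplit]
  have h2 : modular Φ (singularSeq (average T n v - yv)) (2 * a) ≤ 1 :=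
    (modular_le_of_kyFan_le_mul hΦ hv hcv two_pos (hT.kyFan_average_sub_le hv hyv hlev n) a).trans
      hva
  refine (modular_add_le hΦ hcu hcv (2 * a)).trans ((mul_le_mul_right (add_le_add hn h2) _).trans ?_)
  rw [one_add_one_eq_two, ENNReal.inv_mul_cancel two_ne_zero ENNReal.ofNat_ne_top]

end OrliczIdeal

/-! ### Shifts of diagonal operators -/

section Shift

open scoped InnerProductSpace

/-- An infinite cardinal absorbs `ℵ₀`, so even a nonseparable space splits into copies of `ℓ²`, and
a unilateral shift can act on all of them at once. -/
theorem exists_hilbertBasis_prod_nat.{u} {H : Type u} [NormedAddCommGroup H]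
    [InnerProductSpace ℂ H] [CompleteSpace H] (hH : ¬ FiniteDimensional ℂ H) :
    ∃ (κ : Type u) (_ : Nonempty κ), Nonempty (HilbertBasis (κ × ℕ) ℂ H) := by
  obtain ⟨w, b, -⟩ := exists_hilbertBasis ℂ H
  have hinf : Infinite w := by
    by_contra hfin
    rw [not_infinite_iff_finite] at hfin
    have := Fintype.ofFinite w
    exact hH (Module.Basis.finiteDimensional_of_finite b.toOrthonormalBasis.toBasis)
  obtain ⟨e⟩ : Nonempty (w × ℕ ≃ w) := by
    rw [← Cardinal.eq, Cardinal.mk_prod, Cardinal.mk_nat, Cardinal.lift_uzero, Cardinal.lift_aleph0]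
    exact Cardinal.mul_aleph0_eq (Cardinal.aleph0_le_mk w)
  refine ⟨w, inferInstance, ⟨HilbertBasis.mk (b.orthonormal.comp e e.injective) ?_⟩⟩
  rw [e.surjective.range_comp, b.dense_span]

variable {H : Type*} [NormedAddCommGroup H] [InnerProductSpace ℂ H] {κ : Type*}

theorem exists_isometry_apply_eq [CompleteSpace H] {ι : Type*} (b : HilbertBasis ι ℂ H)
    {v : ι → H} (hv : Orthonormal ℂ v) : ∃ S : H →ₗᵢ[ℂ] H, ∀ i, S (b i) = v i := by
  classical
  refine ⟨hv.orthogonalFamily.linearIsometry.comp b.repr.toLinearIsometry, fun i => ?_⟩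
  change hv.orthogonalFamily.linearIsometry (b.repr (b i)) = v i
  rw [b.repr_self, OrthogonalFamily.linearIsometry_apply_single]
  simp

theorem exists_shift_isometry [CompleteSpace H] (b : HilbertBasis (κ × ℕ) ℂ H) :
    ∃ S : H →ₗᵢ[ℂ] H, ∀ p : κ × ℕ, S (b p) = b (p.1, p.2 + 1) := by
  have hinj : Function.Injective fun p : κ × ℕ => (p.1, p.2 + 1) := fun p q h => by
    simp only [Prod.mk.injEq, Nat.add_right_cancel_iff] at h
    exact Prod.ext h.1 h.2
  exact exists_isometry_apply_eq b (b.orthonormal.comp _ hinj)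

/-- The diagonal entries of the operator with entries `η` along the row of index `i`. -/
noncomputable def rowEntries (i : κ) (η : ℕ → ℝ≥0) : κ × ℕ → ℝ≥0 := by
  classical exact fun p => if p.1 = i then η p.2 else 0

theorem rowEntries_self (i : κ) (η : ℕ → ℝ≥0) (n : ℕ) : rowEntries i η (i, n) = η n := by
  simp [rowEntries]

theorem rowEntries_of_ne {i j : κ} (h : j ≠ i) (η : ℕ → ℝ≥0) (n : ℕ) :
    rowEntries i η (j, n) = 0 := by
  simp [rowEntries, h]

theorem rowEntries_le {η : ℕ → ℝ≥0} {C : ℝ≥0} (hη : ∀ n, η n ≤ C) (i : κ) (p : κ × ℕ) :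
    rowEntries i η p ≤ C := by
  rw [rowEntries]
  split_ifs
  exacts [hη _, zero_le]

theorem equimeasurable_rowEntries (i : κ) (η : ℕ → ℝ≥0) :
    Equimeasurable (rowEntries i η) η := by
  intro t
  have hinj : Function.Injective fun n : ℕ => (i, n) := fun m n h => (Prod.ext_iff.1 h).2
  rw [← hinj.encard_image]
  congr 1
  ext ⟨j, n⟩
  constructor
  · intro h
    have h' : t < rowEntries i η (j, n) := h
    rcases eq_or_ne j i with rfl | hne
    · rw [rowEntries_self] at h'
      exact ⟨n, h', rfl⟩
    · rw [rowEntries_of_ne hne] at h'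
      exact absurd h' not_lt_zero
  · rintro ⟨m, hm, heq⟩
    obtain ⟨rfl, rfl⟩ := Prod.ext_iff.1 heq
    change t < rowEntries i η (i, m)
    rwa [rowEntries_self]

/-- A sequence shifted by `k` steps to the right and filled up with zeros. -/
def shiftSeq (k : ℕ) (η : ℕ → ℝ≥0) (m : ℕ) : ℝ≥0 := if k ≤ m then η (m - k) else 0

theorem shiftSeq_le {η : ℕ → ℝ≥0} {C : ℝ≥0} (hη : ∀ n, η n ≤ C) (k m : ℕ) :
    shiftSeq k η m ≤ C := by
  rw [shiftSeq]
  split_ifs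
  exacts [hη _, zero_le]

/-- The Cesàro averages of the right shifts of a sequence. -/
noncomputable def cesaroSeq (η : ℕ → ℝ≥0) (n m : ℕ) : ℝ≥0 :=
  ((n : ℝ≥0) + 1)⁻¹ * ∑ k ∈ Finset.range (n + 1), shiftSeq k η m

theorem cesaroSeq_le {η : ℕ → ℝ≥0} {C : ℝ≥0} (hη : ∀ n, η n ≤ C) (n m : ℕ) :
    cesaroSeq η n m ≤ C := by
  rw [cesaroSeq, inv_mul_le_iff₀ (by positivity)]
  refine (Finset.sum_le_sum fun k _ => shiftSeq_le hη k m).trans_eq ?_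
  rw [Finset.sum_const, Finset.card_range, nsmul_eq_mul]
  push_cast
  rfl

/-- From position `n` on, none of the shifts has brought in zeros, and each shows an earlier, hence
larger, entry. -/
theorem le_cesaroSeq {η : ℕ → ℝ≥0} (hη : Antitone η) {n m : ℕ} (h : n ≤ m) :
    η m ≤ cesaroSeq η n m := by
  rw [cesaroSeq, le_inv_mul_iff₀ (by positivity)]
  have : ((n : ℝ≥0) + 1) * η m = ∑ _k ∈ Finset.range (n + 1), η m := by
    rw [Finset.sum_const, Finset.card_range, nsmul_eq_mul]
    push_cast
    rfl
  rw [this]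
  refine Finset.sum_le_sum fun k hk => ?_
  rw [shiftSeq, if_pos ((Nat.lt_succ_iff.1 (Finset.mem_range.1 hk)).trans h)]
  exact hη (Nat.sub_le m k)

theorem cesaroSeq_single {n m : ℕ} (h : m ≤ n) :
    cesaroSeq (Pi.single 0 1) n m = ((n : ℝ≥0) + 1)⁻¹ := by
  rw [cesaroSeq, Finset.sum_eq_single m]
  · simp [shiftSeq]
  · intro k _ hk
    rw [shiftSeq]
    split_ifs with hkm
    · exact Pi.single_eq_of_ne (by omega) 1
    · rfl
  · intro hm
    exact absurd (Finset.mem_range.2 (by omega)) hm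

/-- Only the first `m + 1` shifts reach position `m`, so the sum stays bounded while its divisor
grows. -/
theorem tendsto_cesaroSeq (η : ℕ → ℝ≥0) (m : ℕ) :
    Tendsto (fun n => cesaroSeq η n m) atTop (𝓝 0) := by
  have hbound : ∀ n, cesaroSeq η n m ≤
      ((n : ℝ≥0) + 1)⁻¹ * ∑ k ∈ Finset.range (m + 1), shiftSeq k η m := by
    intro n
    rw [cesaroSeq]
    refine mul_le_mul_right ?_ _
    refine Finset.sum_le_sum_of_ne_zero fun k _ hk => Finset.mem_range.2 ?_
    by_contra hlt
    exact hk (by rw [shiftSeq, if_neg (by omega)])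
  have hlim : Tendsto (fun n : ℕ => ((n : ℝ≥0) + 1)⁻¹) atTop (𝓝 0) := by
    rw [← NNReal.tendsto_coe]
    simpa [one_div] using tendsto_one_div_add_atTop_nhds_zero_nat (𝕜 := ℝ)
  have hlim' := hlim.mul_const (∑ k ∈ Finset.range (m + 1), shiftSeq k η m)
  rw [zero_mul] at hlim'
  exact tendsto_of_tendsto_of_tendsto_of_le_of_le tendsto_const_nhds hlim' (fun _ => zero_le) hbound

variable [CompleteSpace H]

/-- Conjugation by a bounded operator. -/
noncomputable def conjugation (S : H →L[ℂ] H) : (H →L[ℂ] H) →ₗ[ℂ] (H →L[ℂ] H) where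
  toFun x := S ∘L x ∘L ContinuousLinearMap.adjoint S
  map_add' x y := by rw [ContinuousLinearMap.add_comp, ContinuousLinearMap.comp_add]
  map_smul' c x := by
    rw [ContinuousLinearMap.smul_comp, ContinuousLinearMap.comp_smul, RingHom.id_apply]

/-- Conjugation by a contraction is a Dunford-Schwartz operator. -/
theorem isDunfordSchwartz_conjugation {S : H →L[ℂ] H} (hS : ‖S‖ ≤ 1) :
    IsDunfordSchwartz (conjugation S) := by
  have hcomp : ∀ x : H →L[ℂ] H, IsCompactOperator x → IsCompactOperator (conjugation S x) :=
    fun x hx => (hx.comp_clm _).clm_comp S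
  have htr : ∀ x ∈ traceClass H, traceNorm (conjugation S x) ≤ traceNorm x := fun x hx =>
    traceNorm_le_of_kyFan_le (hcomp x hx.1) fun m =>
      (ENNReal.coe_le_coe.2 (kyFan_conj_le hx.1 hS m)).trans (kyFan_le_traceNorm hx.1 m)
  refine ⟨fun x hx => ⟨hcomp x hx.1, (htr x hx).trans_lt hx.2⟩, htr, fun x => ?_⟩
  calc ‖S ∘L x ∘L ContinuousLinearMap.adjoint S‖
      ≤ ‖S‖ * (‖x‖ * ‖ContinuousLinearMap.adjoint S‖) :=
        (S.opNorm_comp_le _).trans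
          (mul_le_mul_of_nonneg_left (x.opNorm_comp_le _) (norm_nonneg _))
    _ ≤ 1 * (‖x‖ * 1) := by
        rw [LinearIsometryEquiv.norm_map]
        gcongr
    _ = ‖x‖ := by ring

variable {b : HilbertBasis (κ × ℕ) ℂ H} {S : H →L[ℂ] H}

theorem adjoint_shift_succ (hS : ∀ p : κ × ℕ, S (b p) = b (p.1, p.2 + 1)) (j : κ) (n : ℕ) :
    ContinuousLinearMap.adjoint S (b (j, n + 1)) = b (j, n) := by
  classical
  refine ext_inner_hilbertBasis b fun q => ?_
  rw [ContinuousLinearMap.adjoint_inner_right, hS, orthonormal_iff_ite.1 b.orthonormal,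
    orthonormal_iff_ite.1 b.orthonormal]
  congr 1
  rw [Prod.ext_iff, Prod.ext_iff]
  simp

theorem adjoint_shift_zero (hS : ∀ p : κ × ℕ, S (b p) = b (p.1, p.2 + 1)) (j : κ) :
    ContinuousLinearMap.adjoint S (b (j, 0)) = 0 := by
  refine ext_inner_hilbertBasis b fun q => ?_
  rw [ContinuousLinearMap.adjoint_inner_right, hS, inner_zero_right]
  exact b.orthonormal.2 (by simp [Prod.ext_iff])

theorem conjugation_pow_diagonalOp (hS : ∀ p : κ × ℕ, S (b p) = b (p.1, p.2 + 1)) (i : κ)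
    {η : ℕ → ℝ≥0} {C : ℝ≥0} (hη : ∀ n, η n ≤ C) (k : ℕ) :
    ((conjugation S) ^ k) (diagonalOp b (rowEntries i η)) =
      diagonalOp b (rowEntries i (shiftSeq k η)) := by
  induction k with
  | zero =>
    have : shiftSeq 0 η = η := by funext m; simp [shiftSeq]
    rw [this]
    rfl
  | succ k ih =>
    rw [pow_succ', Module.End.mul_apply, ih]
    refine ext_hilbertBasis b fun p => ?_
    obtain ⟨j, n⟩ := p
    rw [diagonalOp_apply b (rowEntries_le (shiftSeq_le hη (k + 1)) i)]
    change S (diagonalOp b (rowEntries i (shiftSeq k η))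
      (ContinuousLinearMap.adjoint S (b (j, n)))) = _
    cases n with
    | zero =>
      rw [adjoint_shift_zero hS, map_zero, map_zero]
      rcases eq_or_ne j i with rfl | hne
      · simp [rowEntries_self, shiftSeq]
      · simp [rowEntries_of_ne hne]
    | succ n =>
      rw [adjoint_shift_succ hS, diagonalOp_apply b (rowEntries_le (shiftSeq_le hη k) i),
        map_smul, hS]
      rcases eq_or_ne j i with rfl | hne
      · simp [rowEntries_self, shiftSeq]
      · simp [rowEntries_of_ne hne]

theorem average_conjugation_diagonalOp (hS : ∀ p : κ × ℕ, S (b p) = b (p.1, p.2 + 1)) (i : κ)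
    {η : ℕ → ℝ≥0} {C : ℝ≥0} (hη : ∀ n, η n ≤ C) (n : ℕ) :
    average (conjugation S) n (diagonalOp b (rowEntries i η)) =
      diagonalOp b (rowEntries i (cesaroSeq η n)) := by
  refine ext_hilbertBasis b fun p => ?_
  obtain ⟨j, m⟩ := p
  rw [diagonalOp_apply b (rowEntries_le (cesaroSeq_le hη n) i), average, smul_apply, sum_apply]
  simp only [conjugation_pow_diagonalOp hS i hη]
  rw [Finset.sum_congr rfl fun k _ => diagonalOp_apply b (rowEntries_le (shiftSeq_le hη k) i) _,
    ← Finset.sum_smul, smul_smul]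
  congr 1
  rcases eq_or_ne j i with rfl | hne
  · simp only [rowEntries_self, cesaroSeq]
    push_cast
    rfl
  · simp [rowEntries_of_ne hne]

end Shift

/-! ### Necessity of the conditions -/

section Necessity

variable {Φ : ℝ≥0 → ℝ≥0}

theorem IsOrliczFunction.map_mul_le (hΦ : IsOrliczFunction Φ) {s : ℝ≥0} (hs : s ≤ 1) (u : ℝ≥0) :
    Φ (s * u) ≤ s * Φ u := by
  have h := hΦ.convex.2 (Set.mem_univ u) (Set.mem_univ 0) (zero_le (a := s))
    (zero_le (a := 1 - s)) (add_tsub_cancel_of_le hs)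
  simpa [hΦ.map_zero] using h

theorem IsOrliczFunction.map_div_le (hΦ : IsOrliczFunction Φ) {t : ℝ≥0} (ht : 1 ≤ t) (u : ℝ≥0) :
    Φ (u / t) ≤ Φ u / t := by
  rw [div_eq_inv_mul, div_eq_inv_mul]
  exact hΦ.map_mul_le (inv_le_one_of_one_le₀ ht) u

theorem IsOrliczFunction.exists_one_lt (hΦ : IsOrliczFunction Φ) : ∃ c : ℝ≥0, 0 < c ∧ 1 < Φ c := by
  obtain ⟨u, hu, hpos⟩ := hΦ.exists_pos
  -- Convexity gives `Φ(t u) ≥ t Φ(u)`, and this `t` makes the right side `Φ(u) + 2`.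
  set t : ℝ≥0 := 1 + 2 / Φ u with ht
  have ht1 : 1 ≤ t := le_self_add
  have ht0 : 0 < t := one_pos.trans_le ht1
  refine ⟨t * u, mul_pos ht0 (pos_iff_ne_zero.2 hu), ?_⟩
  have h := hΦ.map_div_le ht1 (t * u)
  rw [mul_div_cancel_left₀ _ ht0.ne', le_div_iff₀ ht0, ht, mul_add, mul_one,
    mul_div_cancel₀ _ hpos.ne'] at h
  calc (1 : ℝ≥0) < 2 := one_lt_two
    _ ≤ Φ u + 2 := le_add_self
    _ ≤ _ := h

variable {H : Type*} [NormedAddCommGroup H] [InnerProductSpace ℂ H] [CompleteSpace H]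
  {x : H →L[ℂ] H}

theorem modular_antitone (hΦ : IsOrliczFunction Φ) (ξ : ℕ → ℂ) {a a' : ℝ≥0} (ha : 0 < a)
    (h : a ≤ a') : modular Φ ξ a' ≤ modular Φ ξ a :=
  ENNReal.tsum_le_tsum fun _ => ENNReal.coe_le_coe.2
    (hΦ.monotone (div_le_div_of_nonneg_left zero_le ha h))

theorem modular_le_one_of_orliczNorm_lt (hΦ : IsOrliczFunction Φ) (hx : x ∈ orliczIdeal H Φ)
    {a : ℝ≥0} (h : orliczNorm Φ x < a) : modular Φ (singularSeq x) a ≤ 1 := by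
  obtain ⟨a₀, ha₀, hlt⟩ := hx.2.2
  -- Without an admissible scale the Luxemburg infimum would be the default `0`. Convexity divides
  -- the finite modular by `t` when the scale grows by `t ≥ 1`.
  have hne : {a : ℝ≥0 | 0 < a ∧ modular Φ (singularSeq x) a ≤ 1}.Nonempty := by
    set t : ℝ≥0 := 1 + (modular Φ (singularSeq x) a₀).toNNReal with ht
    have ht1 : 1 ≤ t := le_self_add
    have ht0 : 0 < t := one_pos.trans_le ht1
    refine ⟨a₀ * t, mul_pos ha₀ ht0, ?_⟩
    have hle : modular Φ (singularSeq x) (a₀ * t) ≤ (t⁻¹ : ℝ≥0) * modular Φ (singularSeq x) a₀ := by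
      rw [modular, modular, ← ENNReal.tsum_mul_left]
      refine ENNReal.tsum_le_tsum fun n => ?_
      rw [← ENNReal.coe_mul, ENNReal.coe_le_coe, ← div_div, ← div_eq_inv_mul]
      exact hΦ.map_div_le ht1 _
    refine hle.trans ?_
    rw [← ENNReal.coe_toNNReal hlt.ne, ← ENNReal.coe_mul, ← ENNReal.coe_one, ENNReal.coe_le_coe,
      inv_mul_le_iff₀ ht0, mul_one]
    exact le_add_self
  rw [orliczNorm, luxemburgNorm, NNReal.coe_lt_coe] at h
  obtain ⟨a', ⟨ha'0, ha'⟩, hlt'⟩ := (csInf_lt_iff (OrderBot.bddBelow _) hne).1 h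
  exact (modular_antitone hΦ _ ha'0 hlt'.le).trans ha'

theorem nnnorm_le_of_modular_le_one (hΦ : IsOrliczFunction Φ) (hx : IsCompactOperator x)
    {a c : ℝ≥0} (ha : 0 < a) (hc : 1 < Φ c) (h : modular Φ (singularSeq x) a ≤ 1) :
    ‖x‖₊ ≤ c * a := by
  rw [modular_eq_tsum_sv hx] at h
  have h0 : (Φ (sv x 0 / a) : ℝ≥0∞) ≤ 1 := (ENNReal.le_tsum 0).trans h
  have h1 : Φ (sv x 0 / a) ≤ 1 := by exact_mod_cast h0
  rw [← sv_zero_eq hx, ← div_le_iff₀ ha]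
  by_contra! hlt
  exact absurd (hc.trans_le (hΦ.monotone hlt.le)) (not_lt.2 h1)

/-- The mean ergodic theorem, applied to a shift and diagonal operators. -/
theorem eventually_tsum_cesaroSeq_le_one (hH : ¬ FiniteDimensional ℂ H)
    (hΦ : IsOrliczFunction Φ) (hmet : MeanErgodicTheorem (orliczIdeal H Φ) (orliczNorm Φ))
    {η : ℕ → ℝ≥0} (hη : FiniteSuperlevels η) (hsum : ∑' m, (Φ (η m) : ℝ≥0∞) < ∞)
    {a : ℝ≥0} (ha : 0 < a) :
    ∀ᶠ n in atTop, ∑' m, (Φ (cesaroSeq η n m / a) : ℝ≥0∞) ≤ 1 := by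
  obtain ⟨κ, ⟨i⟩, ⟨b⟩⟩ := exists_hilbertBasis_prod_nat hH
  obtain ⟨S₀, hS₀⟩ := exists_shift_isometry b
  set S : H →L[ℂ] H := S₀.toContinuousLinearMap with hSdef
  have hS : ∀ p : κ × ℕ, S (b p) = b (p.1, p.2 + 1) := hS₀
  have hSn : ‖S‖ ≤ 1 := S₀.norm_toContinuousLinearMap_le
  have hT := isDunfordSchwartz_conjugation hSn
  obtain ⟨C, hC⟩ := hη.exists_bound
  set x : H →L[ℂ] H := diagonalOp b (rowEntries i η) with hx
  have hxc : IsCompactOperator x := isCompactOperator_diagonalOp b fun t ht => by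
    rw [← Set.encard_lt_top_iff, equimeasurable_rowEntries i η t, Set.encard_lt_top_iff]
    exact hη t ht
  have hmod : ∀ {ζ : ℕ → ℝ≥0} (hζ : ∀ m, ζ m ≤ C)
      (_ : IsCompactOperator (diagonalOp b (rowEntries i ζ))) {a : ℝ≥0} (_ : 0 < a),
      modular Φ (singularSeq (diagonalOp b (rowEntries i ζ))) a =
        ∑' m, (Φ (ζ m / a) : ℝ≥0∞) := by
    intro ζ hζ hcomp a ha
    rw [(isEigenbasis_diagonalOp b (rowEntries_le hζ i)).modular_eq hΦ hcomp ha]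
    exact (((equimeasurable_rowEntries i ζ).div ha).comp hΦ.monotone hΦ.map_zero
      hΦ.leftContinuous).tsum_eq
  have hxmem : x ∈ orliczIdeal H Φ := by
    refine mem_orliczIdeal_iff.2 ⟨hxc, 1, one_pos, ?_⟩
    rw [hmod hC hxc one_pos]
    simpa using hsum
  obtain ⟨y, hy, hmem, hlim⟩ := hmet x hxmem _ hT
  obtain ⟨c, hc0, hc⟩ := hΦ.exists_one_lt
  have hev : ∀ a : ℝ≥0, 0 < a →
      ∀ᶠ n in atTop, modular Φ (singularSeq (average (conjugation S) n x - y)) a ≤ 1 := by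
    intro a ha
    filter_upwards [hlim.eventually (gt_mem_nhds (show (0 : ℝ) < a from ha))] with n hn
    exact modular_le_one_of_orliczNorm_lt hΦ (hmem n) hn
  -- The Orlicz norm dominates the operator norm up to the constant `c`, so the limit can be
  -- computed on basis vectors, where the averaged entries tend to `0`.
  have hnorm : Tendsto (fun n => average (conjugation S) n x) atTop (𝓝 y) := by
    rw [tendsto_iff_norm_sub_tendsto_zero]
    refine tendsto_order.2 ⟨fun ε hε => Eventually.of_forall fun n =>
      hε.trans_le (norm_nonneg _), fun ε hε => ?_⟩
    have hpos : 0 < (ε / 2).toNNReal / c := div_pos (by simpa using hε) hc0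
    filter_upwards [hev _ hpos] with n hn
    have h := nnnorm_le_of_modular_le_one hΦ (hmem n).1 hpos hc hn
    rw [mul_div_cancel₀ _ hc0.ne', ← NNReal.coe_le_coe, Real.coe_toNNReal _ (by positivity),
      coe_nnnorm] at h
    linarith
  have hav : ∀ n, average (conjugation S) n x = diagonalOp b (rowEntries i (cesaroSeq η n)) :=
    average_conjugation_diagonalOp hS i hC
  have hy0 : y = 0 := by
    refine ext_hilbertBasis b fun p => ?_
    obtain ⟨j, m⟩ := p
    have h1 : Tendsto (fun n => average (conjugation S) n x (b (j, m))) atTop (𝓝 (y (b (j, m)))) :=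
      ((ContinuousLinearMap.apply ℂ H (b (j, m))).continuous.tendsto y).comp hnorm
    have h2 : Tendsto (fun n => average (conjugation S) n x (b (j, m))) atTop (𝓝 0) := by
      simp only [hav, diagonalOp_apply b (rowEntries_le (cesaroSeq_le hC _) i)]
      rcases eq_or_ne j i with rfl | hne
      · simp only [rowEntries_self]
        have h3 : Tendsto (fun n => ((cesaroSeq η n m : ℝ) : ℂ)) atTop (𝓝 ((0 : ℝ) : ℂ)) :=
          (Complex.continuous_ofReal.tendsto 0).comp (NNReal.tendsto_coe.2 (tendsto_cesaroSeq η m))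
        simpa using h3.smul_const (b (j, m))
      · simp only [rowEntries_of_ne hne, NNReal.coe_zero, Complex.ofReal_zero, zero_smul]
        exact tendsto_const_nhds
    exact tendsto_nhds_unique h1 h2
  filter_upwards [hev a ha] with n hn
  rw [hy0, sub_zero, hav, hmod (cesaroSeq_le hC n) (hav n ▸ hT.average_isCompactOperator hxc n) ha]
    at hn
  exact hn

/-- The test operator is a rank one projection, whose averages have `n + 1` equal entries `1/(n +
1)`. This controls `Φ(u)/u` at a single point, and convexity carries the bound to all smaller
arguments. -/
theorem tendsto_div_of_meanErgodicTheorem (hH : ¬ FiniteDimensional ℂ H)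
    (hΦ : IsOrliczFunction Φ) (hmet : MeanErgodicTheorem (orliczIdeal H Φ) (orliczNorm Φ)) :
    Tendsto (fun u : ℝ≥0 => Φ u / u) (𝓝[≠] 0) (𝓝 0) := by
  have hη : FiniteSuperlevels (Pi.single 0 1 : ℕ → ℝ≥0) := by
    intro t _
    refine (Set.finite_singleton 0).subset fun n hn => ?_
    by_contra hne
    have hn' : t < (Pi.single 0 1 : ℕ → ℝ≥0) n := hn
    rw [Pi.single_eq_of_ne hne] at hn'
    exact not_lt_zero hn'
  have hsum : ∑' m, (Φ ((Pi.single 0 1 : ℕ → ℝ≥0) m) : ℝ≥0∞) < ∞ := by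
    rw [tsum_eq_single 0 fun m hm => by rw [Pi.single_eq_of_ne hm, hΦ.map_zero]; rfl]
    exact ENNReal.coe_lt_top
  refine tendsto_order.2 ⟨fun a ha => absurd ha not_lt_zero, fun ε hε => ?_⟩
  have ha : 0 < ε / 2 := half_pos hε
  obtain ⟨n, hn⟩ := (eventually_tsum_cesaroSeq_le_one hH hΦ hmet hη hsum ha).exists
  set u : ℝ≥0 := ((n : ℝ≥0) + 1)⁻¹ / (ε / 2) with hu
  have hu0 : 0 < u := by positivity
  have hle : ((n : ℝ≥0) + 1) * Φ u ≤ 1 := by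
    have h1 := (ENNReal.sum_le_tsum (Finset.range (n + 1))).trans hn
    rw [Finset.sum_congr rfl fun m hm => by
      rw [cesaroSeq_single (Nat.lt_succ_iff.1 (Finset.mem_range.1 hm)), ← hu]] at h1
    rw [Finset.sum_const, Finset.card_range, nsmul_eq_mul] at h1
    exact_mod_cast h1
  have hΦu : Φ u ≤ ε / 2 * u := by
    rw [hu, mul_div_cancel₀ _ ha.ne', ← hu, ← one_div, le_div_iff₀' (by positivity)]
    exact hle
  rw [eventually_nhdsWithin_iff]
  filter_upwards [gt_mem_nhds hu0] with v hv hv0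
  have hvpos : 0 < v := pos_iff_ne_zero.2 hv0
  rw [div_lt_iff₀ hvpos]
  have h1 := hΦ.map_mul_le (div_le_one_of_le₀ (le_of_lt hv) zero_le) u
  rw [div_mul_cancel₀ _ hu0.ne'] at h1
  calc Φ v ≤ v / u * Φ u := h1
    _ ≤ v / u * (ε / 2 * u) := mul_le_mul_right hΦu _
    _ = ε / 2 * v := by field_simp
    _ < ε * v := mul_lt_mul_of_pos_right (half_lt_self hε) hvpos

/-- If the `Δ₂`-condition fails, the modular may be finite for a family but not for its double. -/
theorem exists_tsum_lt_top_of_not_deltaTwo (hΦ : IsOrliczFunction Φ)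
    (hpos : ∀ u : ℝ≥0, u ≠ 0 → 0 < Φ u) (hΔ : ¬ DeltaTwoAtZero Φ) :
    ∃ η : ℕ → ℝ≥0, Antitone η ∧ FiniteSuperlevels η ∧ ∑' m, (Φ (η m) : ℝ≥0∞) < ∞ ∧
      ∑' m, (Φ (2 * η m) : ℝ≥0∞) = ∞ := by
  have hex : ∀ j : ℕ, ∃ u : ℝ≥0, u ≠ 0 ∧ Φ u ≤ (2 ^ j)⁻¹ ∧ 2 ^ j * Φ u ≤ Φ (2 * u) := by
    intro j
    simp only [DeltaTwoAtZero, not_exists, not_and, not_forall, not_lt] at hΔ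
    -- The threshold ensures `u ≤ 1` and `Φ(u) ≤ u Φ(1) ≤ 2⁻ʲ`.
    obtain ⟨u, hu0, hu, hle⟩ := hΔ ((2 ^ j)⁻¹ / (Φ 1 + 1)) (by positivity) (2 ^ j) (by positivity)
    refine ⟨u, hu0.ne', ?_, hle⟩
    rw [lt_div_iff₀ (by positivity)] at hu
    have hone : (2 ^ j : ℝ≥0)⁻¹ ≤ 1 := inv_le_one_of_one_le₀ (one_le_pow₀ one_le_two)
    have hu1 : u ≤ 1 := by
      refine le_trans ?_ (hu.le.trans hone)
      rw [mul_add, mul_one]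
      exact le_add_self
    have h1 := hΦ.map_mul_le hu1 1
    rw [mul_one] at h1
    refine h1.trans (le_trans ?_ hu.le)
    exact mul_le_mul_right le_self_add _
  choose u hu0 hu hu2 using hex
  -- Repeating `u j` this often gives a block with `Φ`-sum between `2⁻ʲ` and `2 · 2⁻ʲ`: the blocks
  -- are summable, but each contributes at least `1` after doubling.
  let N : ℕ → ℕ := fun j => ⌈(2 ^ j)⁻¹ / Φ (u j)⌉₊
  have hN1 : ∀ j, (N j : ℝ≥0) * Φ (u j) ≤ 2 * (2⁻¹) ^ j := by
    intro j
    have h := (Nat.ceil_lt_add_one (zero_le (a := (2 ^ j)⁻¹ / Φ (u j)))).le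
    calc (N j : ℝ≥0) * Φ (u j) ≤ ((2 ^ j)⁻¹ / Φ (u j) + 1) * Φ (u j) := mul_le_mul_left h _
      _ = (2 ^ j)⁻¹ + Φ (u j) := by
          rw [add_mul, div_mul_cancel₀ _ (hpos _ (hu0 j)).ne', one_mul]
      _ ≤ (2 ^ j)⁻¹ + (2 ^ j)⁻¹ := by gcongr; exact hu j
      _ = 2 * (2⁻¹) ^ j := by rw [inv_pow]; ring
  have hN2 : ∀ j, 1 ≤ (N j : ℝ≥0) * Φ (2 * u j) := by
    intro j
    have h := Nat.le_ceil ((2 ^ j)⁻¹ / Φ (u j))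
    rw [div_le_iff₀ (hpos _ (hu0 j))] at h
    calc (1 : ℝ≥0) = 2 ^ j * (2 ^ j)⁻¹ := (mul_inv_cancel₀ (by positivity)).symm
      _ ≤ 2 ^ j * (N j * Φ (u j)) := mul_le_mul_right h _
      _ = N j * (2 ^ j * Φ (u j)) := by ring
      _ ≤ N j * Φ (2 * u j) := mul_le_mul_right (hu2 j) _
  let f : (Σ j, Fin (N j)) → ℝ≥0 := fun p => u p.1
  have htsum : ∀ g : ℝ≥0 → ℝ≥0,
      ∑' p, (g (f p) : ℝ≥0∞) = ∑' j, ((N j * g (u j) : ℝ≥0) : ℝ≥0∞) := by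
    intro g
    rw [ENNReal.tsum_sigma']
    refine tsum_congr fun j => ?_
    simp only [f]
    rw [tsum_fintype, Finset.sum_const, Finset.card_univ, Fintype.card_fin, nsmul_eq_mul]
    push_cast
    rfl
  have hlt : ∑' p, (Φ (f p) : ℝ≥0∞) < ∞ := by
    rw [htsum Φ]
    refine (ENNReal.tsum_le_tsum fun j => ENNReal.coe_le_coe.2 (hN1 j)).trans_lt ?_
    refine lt_top_iff_ne_top.2 (ENNReal.tsum_coe_ne_top_iff_summable.2 ?_)
    exact (NNReal.summable_geometric (inv_lt_one_of_one_lt₀ one_lt_two)).mul_left 2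
  have hinf : ∑' p, (Φ (2 * f p) : ℝ≥0∞) = ∞ := by
    rw [htsum fun v => Φ (2 * v)]
    refine top_le_iff.1 (le_trans (le_of_eq ?_)
      (ENNReal.tsum_le_tsum fun j => ENNReal.coe_le_coe.2 (hN2 j)))
    rw [ENNReal.coe_one, ENNReal.tsum_const_eq_top_of_ne_zero one_ne_zero]
  -- As `Φ(t) > 0` for `t > 0`, a convergent sum has only finitely many entries above `t`; this
  -- permits sorting the blocks into one decreasing sequence.
  have hfs : FiniteSuperlevels f := by
    intro t ht
    refine (ENNReal.finite_const_le_of_tsum_ne_top hlt.ne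
      (ENNReal.coe_ne_zero.2 (hpos t ht.ne').ne')).subset fun p hp => ?_
    exact ENNReal.coe_le_coe.2 (hΦ.monotone (le_of_lt hp))
  have heq := equimeasurable_rearrangement hfs
  refine ⟨rearrangement f, rearrangement_antitone hfs, heq.finiteSuperlevels hfs, ?_, ?_⟩
  · rw [← (heq.comp hΦ.monotone hΦ.map_zero hΦ.leftContinuous).tsum_eq]
    exact hlt
  · have h := ((heq.div (a := 2⁻¹) (by positivity)).comp hΦ.monotone hΦ.map_zero
      hΦ.leftContinuous).tsum_eq
    simp only [div_inv_eq_mul, mul_comm _ (2 : ℝ≥0)] at h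
    rw [← h]
    exact hinf

/-- Past position `n` the averaged sequence dominates the decreasing `η`. A modular at most `1` at
scale `1/2` would therefore bound a tail of `∑ Φ(2η)`, which diverges. -/
theorem deltaTwoAtZero_of_meanErgodicTheorem (hH : ¬ FiniteDimensional ℂ H)
    (hΦ : IsOrliczFunction Φ) (hpos : ∀ u : ℝ≥0, u ≠ 0 → 0 < Φ u)
    (hmet : MeanErgodicTheorem (orliczIdeal H Φ) (orliczNorm Φ)) : DeltaTwoAtZero Φ := by
  by_contra hΔ
  obtain ⟨η, hanti, hη, hsum, hinf⟩ := exists_tsum_lt_top_of_not_deltaTwo hΦ hpos hΔ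
  obtain ⟨n, hn⟩ := (eventually_tsum_cesaroSeq_le_one hH hΦ hmet hη hsum
    (a := 2⁻¹) (by positivity)).exists
  have hle : ∀ m, (Φ (2 * η m) : ℝ≥0∞) ≤
      Φ (cesaroSeq η n m / 2⁻¹) + if m ∈ Finset.range n then (Φ (2 * η m) : ℝ≥0∞) else 0 := by
    intro m
    by_cases hm : m ∈ Finset.range n
    · rw [if_pos hm]; exact le_add_self
    · rw [if_neg hm, add_zero, div_inv_eq_mul, mul_comm _ (2 : ℝ≥0)]
      exact ENNReal.coe_le_coe.2 (hΦ.monotone (mul_le_mul_right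
        (le_cesaroSeq hanti (not_lt.1 (Finset.mem_range.not.1 hm))) _))
  have htop := (ENNReal.tsum_le_tsum hle).trans_lt (b := ∑' m, _) (c := ∞) <| by
    rw [ENNReal.tsum_add, tsum_eq_sum (s := Finset.range n) fun m hm => if_neg hm]
    refine ENNReal.add_lt_top.2 ⟨hn.trans_lt ENNReal.one_lt_top, ENNReal.sum_lt_top.2 fun m hm => ?_⟩
    rw [if_pos hm]
    exact ENNReal.coe_lt_top
  exact htop.ne hinf

end Necessity

end OrliczIdeal

theorem theorem5p1 {H : Type*} [NormedAddCommGroup H] [InnerProductSpace ℂ H] [CompleteSpace H]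
    (hH : ¬ FiniteDimensional ℂ H)
    (Φ : ℝ≥0 → ℝ≥0) (hΦ : OrliczIdeal.IsOrliczFunction Φ) (hpos : ∀ u : ℝ≥0, u ≠ 0 → 0 < Φ u) :
    OrliczIdeal.IndividualErgodicTheorem (OrliczIdeal.orliczIdeal H Φ) ∧
    (OrliczIdeal.MeanErgodicTheorem (OrliczIdeal.orliczIdeal H Φ) (OrliczIdeal.orliczNorm Φ) ↔
      OrliczIdeal.DeltaTwoAtZero Φ ∧
        Tendsto (fun u : ℝ≥0 => Φ u / u) (𝓝[≠] 0) (𝓝 0)) :=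
  ⟨OrliczIdeal.individualErgodicTheorem_orliczIdeal hΦ,
    fun h => ⟨OrliczIdeal.deltaTwoAtZero_of_meanErgodicTheorem hH hΦ hpos h,
      OrliczIdeal.tendsto_div_of_meanErgodicTheorem hH hΦ h⟩,
    fun h => OrliczIdeal.meanErgodicTheorem_orliczIdeal hΦ h.1 h.2⟩
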